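/- Let $\mathbb{C}_+=\{w\in\mathbb{C}:\operatorname{Re} w>0\}$ and let $H^2(\mathbb{C}_+)$ be the Hilbert space of analytic functions $f$ on $\mathbb{C}_+$ for which $$\|f\|^2=\sup_{0<x<\infty}\int_{-\infty}^{\infty}|f(x+iy)|^2\,dy$$ is finite. Let $a>0$ and $b\in\mathbb{C}$ with $\operatorname{Re} b\ge 0$, let $\phi(w)=aw+b$ be the corresponding affine self-map of $\mathbb{C}_+$, and let $C_\phi f=f\circ\phi$ be the (bounded) composition operator on $H^2(\mathbb{C}_+)$. A bounded operator $T$ on a Hilbert space $\mathcal{H}$ is complex symmetric if $CT=T^*C$ for some conjugation $C$, that is, a conjugate-linear map $C:\mathcal{H}\to\mathcal{H}$ with $\langle Cf,Cg\rangle=\langle g,f\rangle$ for all $f,g\in\mathcal{H}$ and $C^2=I$. It is cyclic if there is $f\in\mathcal{H}$ such that the linear span of $\{T^nf:n\ge 0\}$ is dense in $\mathcal{H}$. Then: 1. $C_\phi$ is complex symmetric if and only if $a=1$ or $\operatorname{Re} b=0$. 2. $C_\phi$ is complex symmetric if and only if $C_\phi$ is normal. 3. If $a<1$ and $\operatorname{Re}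 b>0$ (type I), then $C_\phi$ is not cyclic. 4. If $a>1$ and $\operatorname{Re} b>0$ (type II), then $C_\phi$ is cyclic. 5. $C_\phi=a^{-1}C_\psi^*$, where $\psi(w)=a^{-1}w+a^{-1}\overline{b}$. In particular, each type II operator is a scalar multiple of the adjoint of a type I operator. -/

import Mathlib

namespace HalfPlaneHardy

open Complex MeasureTheory Filter Topology
open scoped ENNReal ComplexConjugate

/-- The open right half-plane `ℂ₊`. -/
def rightHalfPlane : Set ℂ := {w | 0 < w.re}

/-- The integral `∫ |f(x + iy)|² dy` over the vertical line `Re w = x`, with values in `[0, ∞]`. -/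
noncomputable def lineIntegral (f : ℂ → ℂ) (x : ℝ) : ℝ≥0∞ :=
  ∫⁻ y : ℝ, ‖f (x + y * I)‖ₑ ^ 2

/-- The squared Hardy norm `sup_{0 < x < ∞} ∫ |f(x + iy)|² dy`, with values in `[0, ∞]`. -/
noncomputable def hardySq (f : ℂ → ℂ) : ℝ≥0∞ :=
  ⨆ (x : ℝ) (_ : 0 < x), lineIntegral f x

lemma isOpen_rightHalfPlane : IsOpen rightHalfPlane :=
  isOpen_lt continuous_const continuous_re

lemma lineIntegral_le_hardySq (f : ℂ → ℂ) {x : ℝ} (hx : 0 < x) :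
    lineIntegral f x ≤ hardySq f :=
  le_iSup₂ (f := fun (x : ℝ) (_ : 0 < x) => lineIntegral f x) x hx

lemma lineIntegral_eq (f : ℂ → ℂ) (x : ℝ) :
    lineIntegral f x = eLpNorm (fun y : ℝ => f (x + y * I)) 2 volume ^ 2 := by
  have := eLpNorm_nnreal_pow_eq_lintegral (μ := (volume : Measure ℝ))
    (f := fun y : ℝ => f (x + y * I)) (p := 2) (by norm_num)
  simp only [ENNReal.coe_ofNat, NNReal.coe_ofNat, ENNReal.rpow_ofNat] at this
  exact this.symm

lemma continuousOn_line {f : ℂ → ℂ} (hf : DifferentiableOn ℂ f rightHalfPlane) {z : ℂ}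
    (hz : 0 < z.re) : Continuous fun y : ℝ => f (z + y * I) := by
  refine hf.continuousOn.comp_continuous (by fun_prop) fun y => ?_
  simpa [rightHalfPlane] using hz

lemma intervalIntegral_sq_le {f : ℂ → ℂ} (hf : DifferentiableOn ℂ f rightHalfPlane) {z : ℂ}
    (hz : 0 < z.re) {N : ℝ} (hN : 0 ≤ N) (h : lineIntegral f z.re ≤ ENNReal.ofReal N) {a b : ℝ}
    (hab : a ≤ b) : ∫ y in a..b, ‖f (z + y * I)‖ ^ 2 ≤ N := by
  rw [intervalIntegral.integral_of_le hab, integral_eq_lintegral_of_nonneg_ae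
    (Eventually.of_forall fun _ => by positivity)
    (by exact ((continuousOn_line hf hz).norm.pow 2).aestronglyMeasurable)]
  refine ENNReal.toReal_le_of_le_ofReal hN (le_trans ?_ h)
  refine (setLIntegral_le_lintegral _ _).trans ?_
  have hm : ∀ y : ℝ, ENNReal.ofReal (‖f (z + y * I)‖ ^ 2) = ‖f (z + y * I)‖ₑ ^ 2 := fun y => by
    rw [ENNReal.ofReal_pow (norm_nonneg _), ofReal_norm]
  simp only [hm, lineIntegral]
  rw [← lintegral_add_right_eq_self (fun y : ℝ => ‖f (z.re + y * I)‖ₑ ^ 2) z.im]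
  refine le_of_eq (lintegral_congr fun y => ?_)
  congr 3
  apply Complex.ext <;> simp [add_comm]

lemma lineIntegral_le_of_interval {f : ℂ → ℂ} (hf : DifferentiableOn ℂ f rightHalfPlane) {x : ℝ}
    (hx : 0 < x) {N : ℝ}
    (h : ∀ R : ℝ, 0 ≤ R → ∫ y in (-R)..R, ‖f (x + y * I)‖ ^ 2 ≤ N) :
    lineIntegral f x ≤ ENNReal.ofReal N := by
  have hc : Continuous fun y : ℝ => f (x + y * I) := continuousOn_line hf (by simpa using hx)
  have hcov : AECover (volume : Measure ℝ) atTop fun n : ℕ => Set.Ioc (-(n : ℝ)) (n : ℝ) :=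
    aecover_Ioc (tendsto_neg_atTop_atBot.comp tendsto_natCast_atTop_atTop)
      tendsto_natCast_atTop_atTop
  refine le_of_tendsto (hcov.lintegral_tendsto_of_nat
    (f := fun y : ℝ => ‖f (x + y * I)‖ₑ ^ 2) (hc.enorm.measurable.pow_const 2).aemeasurable) (Eventually.of_forall fun n => ?_)
  have hi : IntegrableOn (fun y : ℝ => ‖f (x + y * I)‖ ^ 2) (Set.Ioc (-(n : ℝ)) n) :=
    ((hc.norm.pow 2).integrableOn_Icc).mono_set Set.Ioc_subset_Icc_self
  have hn := h n (by positivity)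
  rw [intervalIntegral.integral_of_le (by linarith [(Nat.cast_nonneg n : (0 : ℝ) ≤ n)])] at hn
  refine le_trans (le_of_eq ?_) (ENNReal.ofReal_le_ofReal hn)
  rw [ofReal_integral_eq_lintegral_ofReal hi (Eventually.of_forall fun _ => by positivity)]
  exact lintegral_congr fun y => by rw [ENNReal.ofReal_pow (norm_nonneg _), ofReal_norm]

lemma hasDerivAt_intervalIntegral {f : ℂ → ℂ} (hf : DifferentiableOn ℂ f rightHalfPlane)
    {g : ℝ → ℂ} (hg : Continuous g) (a b : ℝ) {z : ℂ} (hz : 0 < z.re) :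
    HasDerivAt (fun w : ℂ => ∫ y in a..b, g y * f (w + y * I))
      (∫ y in a..b, g y * deriv f (z + y * I)) z := by
  have hd : DifferentiableOn ℂ (deriv f) rightHalfPlane := hf.deriv isOpen_rightHalfPlane
  have hsub : ∀ w ∈ Metric.closedBall z (z.re / 2), 0 < w.re := fun w hw => by
    rw [mem_closedBall_iff_norm] at hw
    have h1 := abs_le.1 ((abs_re_le_norm (w - z)).trans hw)
    rw [sub_re] at h1
    linarith [h1.1]
  have hcomp : IsCompact (Metric.closedBall z (z.re / 2) ×ˢ Set.uIcc a b) :=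
    (isCompact_closedBall _ _).prod isCompact_uIcc
  have hcont : ContinuousOn (fun p : ℂ × ℝ => g p.2 * deriv f (p.1 + p.2 * I))
      (Metric.closedBall z (z.re / 2) ×ˢ Set.uIcc a b) := by
    refine (hg.comp continuous_snd).continuousOn.mul
      (hd.continuousOn.comp (by fun_prop) fun p hp => ?_)
    simpa [rightHalfPlane] using hsub p.1 hp.1
  obtain ⟨K, hK⟩ := hcomp.exists_bound_of_continuousOn hcont
  refine (intervalIntegral.hasDerivAt_integral_of_dominated_loc_of_deriv_le
    (F := fun w y => g y * f (w + y * I)) (F' := fun w y => g y * deriv f (w + y * I))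
    (bound := fun _ => K)
    (Metric.ball_mem_nhds z (half_pos hz)) ?_ ?_ ?_ ?_ ?_ ?_).2
  · filter_upwards [isOpen_rightHalfPlane.mem_nhds hz] with w hw
    exact (hg.mul (continuousOn_line hf hw)).aestronglyMeasurable
  · exact (hg.mul (continuousOn_line hf hz)).intervalIntegrable _ _
  · exact (hg.mul (continuousOn_line hd hz)).aestronglyMeasurable
  · exact Eventually.of_forall fun y hy w hw =>
      hK (w, y) ⟨Metric.ball_subset_closedBall hw, Set.uIoc_subset_uIcc hy⟩
  · exact intervalIntegrable_const
  · refine Eventually.of_forall fun y _ w hw => ?_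
    have hw' : w + y * I ∈ rightHalfPlane := by
      simpa [rightHalfPlane] using hsub w (Metric.ball_subset_closedBall hw)
    have h1 := (hf.differentiableAt (isOpen_rightHalfPlane.mem_nhds hw')).hasDerivAt
    simpa using (h1.comp_add_const w (y * I)).const_mul (g y)

lemma norm_intervalIntegral_mul_le {f : ℂ → ℂ} (hf : DifferentiableOn ℂ f rightHalfPlane)
    {g : ℝ → ℂ} (hg : Continuous g) {a b : ℝ} (hab : a ≤ b) {z : ℂ} (hz : 0 < z.re) :
    ‖∫ y in a..b, g y * f (z + y * I)‖ ≤
      ((∫ y in a..b, ‖g y‖ ^ 2) + ∫ y in a..b, ‖f (z + y * I)‖ ^ 2) / 2 := by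
  have hc : Continuous fun y : ℝ => ‖f (z + y * I)‖ ^ 2 := (continuousOn_line hf hz).norm.pow 2
  have hg' : Continuous fun y : ℝ => ‖g y‖ ^ 2 := hg.norm.pow 2
  refine (intervalIntegral.norm_integral_le_integral_norm hab).trans ?_
  rw [← intervalIntegral.integral_add (hg'.intervalIntegrable _ _)
    (hc.intervalIntegrable _ _), ← intervalIntegral.integral_div]
  refine intervalIntegral.integral_mono_on hab
    ((hg.mul (continuousOn_line hf hz)).norm.intervalIntegrable _ _)
    (((hg'.add hc).div_const 2).intervalIntegrable _ _) fun y _ => ?_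
  rw [norm_mul]
  nlinarith [sq_nonneg (‖g y‖ - ‖f (z + y * I)‖)]

/-- The means `∫ |f(x + iy)|² dy` decrease in `x`. -/
lemma lineIntegral_antitone {f : ℂ → ℂ} (hf : DifferentiableOn ℂ f rightHalfPlane)
    (hfin : hardySq f < ∞) {x₀ x : ℝ} (hx₀ : 0 < x₀) (hx : x₀ ≤ x) :
    lineIntegral f x ≤ lineIntegral f x₀ := by
  have hx' : 0 < x := hx₀.trans_le hx
  have hfin₀ : lineIntegral f x₀ ≠ ∞ := ((lineIntegral_le_hardySq f hx₀).trans_lt hfin).ne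
  rw [← ENNReal.ofReal_toReal hfin₀]
  refine lineIntegral_le_of_interval hf hx' fun R hR => ?_
  have hRR : -R ≤ R := by linarith
  set A : ℝ := ∫ y in (-R)..R, ‖f (x + y * I)‖ ^ 2 with hA
  have hc : Continuous fun y : ℝ => f (x + y * I) := continuousOn_line hf (by simpa using hx')
  set g : ℝ → ℂ := fun y => conj (f (x + y * I)) with hgdef
  have hg : Continuous g := continuous_conj.comp hc
  have hgA : ∫ y in (-R)..R, ‖g y‖ ^ 2 = A := by simp [hgdef, hA]
  set H : ℂ → ℂ := fun w => ∫ y in (-R)..R, g y * f (w + x₀ + y * I) with hH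
  have hdiff : ∀ w : ℂ, -x₀ < w.re → DifferentiableAt ℂ H w := fun w hw => by
    have := hasDerivAt_intervalIntegral hf hg (-R) R (z := w + x₀) (by simp; linarith)
    exact (this.comp_add_const w (x₀ : ℂ)).differentiableAt
  have hbd : ∀ w : ℂ, 0 ≤ w.re → ‖H w‖ ≤ (A + (hardySq f).toReal) / 2 := fun w hw => by
    have hw' : 0 < (w + x₀ : ℂ).re := by simp; linarith
    refine (norm_intervalIntegral_mul_le hf hg hRR hw').trans ?_
    rw [hgA]
    have := intervalIntegral_sq_le hf hw' ENNReal.toReal_nonneg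
      (by rw [ENNReal.ofReal_toReal hfin.ne]; exact lineIntegral_le_hardySq f hw') hRR
    linarith
  have hmain : ‖H ((x - x₀ : ℝ) : ℂ)‖ ≤ (A + (lineIntegral f x₀).toReal) / 2 := by
    refine PhragmenLindelof.right_half_plane_of_bounded_on_real (f := H) ?_ ?_ ?_ ?_ ?_
    · refine DifferentiableOn.diffContOnCl fun w hw => (hdiff w ?_).differentiableWithinAt
      have h0 : 0 ≤ w.re := by
        have hcl : IsClosed {w : ℂ | 0 ≤ w.re} := isClosed_le continuous_const continuous_re
        refine closure_minimal (fun v hv => ?_) hcl hw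
        exact le_of_lt (show 0 < v.re from hv)
      linarith
    · refine ⟨0, by norm_num, 0, ?_⟩
      simp only [zero_mul, Real.exp_zero]
      refine Asymptotics.IsBigO.of_bound ((A + (hardySq f).toReal) / 2) ?_
      filter_upwards [mem_inf_of_right (mem_principal_self _)] with w hw
      simpa using hbd w (le_of_lt hw)
    · refine ⟨(A + (hardySq f).toReal) / 2, ?_⟩
      rw [eventually_map]
      filter_upwards [eventually_ge_atTop 0] with t ht
      exact hbd t (by simpa using ht)
    · intro t
      have hw' : 0 < (t * I + x₀ : ℂ).re := by simpa using hx₀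
      refine (norm_intervalIntegral_mul_le hf hg hRR hw').trans ?_
      rw [hgA]
      have := intervalIntegral_sq_le hf hw' (ENNReal.toReal_nonneg (a := lineIntegral f x₀))
        (by rw [ENNReal.ofReal_toReal hfin₀]; simp) hRR
      linarith
    · simpa using hx
  have hval : H ((x - x₀ : ℝ) : ℂ) = (A : ℂ) := by
    rw [hA, ← intervalIntegral.integral_ofReal]
    refine intervalIntegral.integral_congr fun y _ => ?_
    simp [hgdef, Complex.conj_mul']
  rw [hval, norm_real] at hmain
  linarith [(le_abs_self A).trans hmain]

/-- Point evaluations are controlled by the Hardy norm. -/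
lemma norm_apply_le {f : ℂ → ℂ} (hf : DifferentiableOn ℂ f rightHalfPlane) {N : ℝ} (hN : 0 < N)
    (h : hardySq f ≤ ENNReal.ofReal (N ^ 2)) {z : ℂ} (hz : 0 < z.re) :
    ‖f z‖ ≤ (1 + 2 / z.re) * N := by
  have hint : ∀ w : ℂ, 0 < w.re → ∀ t : ℝ, 0 ≤ t → t ≤ 1 →
      ‖∫ y in (0 : ℝ)..t, f (w + y * I)‖ ≤ N := fun w hw t h0 h1 => by
    have e1 := norm_intervalIntegral_mul_le hf (g := fun _ => (N : ℂ)) continuous_const h0 hw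
    have e2 := intervalIntegral_sq_le hf hw (sq_nonneg N)
      ((lineIntegral_le_hardySq f hw).trans h) h0
    rw [intervalIntegral.integral_const_mul, norm_mul] at e1
    simp only [norm_real, Real.norm_eq_abs, abs_of_pos hN, intervalIntegral.integral_const,
      smul_eq_mul, sub_zero] at e1
    have : N * ‖∫ y in (0 : ℝ)..t, f (w + y * I)‖ ≤ N * N := by nlinarith [sq_nonneg N]
    exact le_of_mul_le_mul_left this hN
  have hdiff : ∀ t : ℝ, 0 ≤ t → t ≤ 1 → ‖f (z + t * I) - f z‖ ≤ 2 / z.re * N :=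
    fun t h0 h1 => by
    have hsub : ∀ w ∈ Metric.closedBall z (z.re / 2), 0 < w.re := fun w hw => by
      rw [mem_closedBall_iff_norm] at hw
      have h1 := abs_le.1 ((abs_re_le_norm (w - z)).trans hw)
      rw [sub_re] at h1
      linarith [h1.1]
    have hder : ∀ w : ℂ, 0 < w.re → HasDerivAt (fun w : ℂ => ∫ y in (0 : ℝ)..t, f (w + y * I))
        (∫ y in (0 : ℝ)..t, deriv f (w + y * I)) w := fun w hw => by
      simpa using hasDerivAt_intervalIntegral hf (g := fun _ => 1) continuous_const 0 t hw
    have hcau := Complex.norm_deriv_le_of_forall_mem_sphere_norm_le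
      (f := fun w : ℂ => ∫ y in (0 : ℝ)..t, f (w + y * I)) (half_pos hz) (C := N) (c := z)
      (DifferentiableOn.diffContOnCl fun w hw =>
        (hder w (hsub w (closure_minimal Metric.ball_subset_closedBall
          Metric.isClosed_closedBall hw))).differentiableAt.differentiableWithinAt)
      fun w hw => hint w (hsub w (Metric.sphere_subset_closedBall hw)) t h0 h1
    rw [(hder z hz).deriv] at hcau
    have hd : DifferentiableOn ℂ (deriv f) rightHalfPlane := hf.deriv isOpen_rightHalfPlane
    have hftc : ∫ y in (0 : ℝ)..t, I * deriv f (z + y * I) = f (z + t * I) - f z := by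
      have := intervalIntegral.integral_eq_sub_of_hasDerivAt
        (f := fun y : ℝ => f (z + y * I)) (f' := fun y : ℝ => I * deriv f (z + y * I))
        (a := 0) (b := t) (fun y _ => ?_)
        ((continuous_const.mul (continuousOn_line hd hz)).intervalIntegrable _ _)
      · simpa using this
      · have hw : z + y * I ∈ rightHalfPlane := by simpa [rightHalfPlane] using hz
        have h1 := (hf.differentiableAt (isOpen_rightHalfPlane.mem_nhds hw)).hasDerivAt
        have h2 : HasDerivAt (fun y : ℝ => z + y * I) I y := by
          simpa using ((ofRealCLM.hasDerivAt (x := y)).mul_const I).const_add z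
        rw [mul_comm]
        exact h1.comp y h2
    rw [intervalIntegral.integral_const_mul] at hftc
    rw [← hftc, norm_mul, norm_I, one_mul]
    refine hcau.trans (le_of_eq ?_)
    field_simp
  have hc := continuousOn_line hf hz
  have hsum : f z = (∫ y in (0 : ℝ)..1, f (z + y * I)) -
      ∫ y in (0 : ℝ)..1, (f (z + y * I) - f z) := by
    rw [intervalIntegral.integral_sub (hc.intervalIntegrable _ _) intervalIntegrable_const]
    simp
  have h2 : ‖∫ y in (0 : ℝ)..1, (f (z + y * I) - f z)‖ ≤ 2 / z.re * N := by
    have := intervalIntegral.norm_integral_le_of_norm_le_const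
      (f := fun y : ℝ => f (z + y * I) - f z) (a := 0) (b := 1) (C := 2 / z.re * N)
      fun y hy => by
        rw [Set.uIoc_of_le zero_le_one] at hy
        exact hdiff y hy.1.le hy.2
    simpa using this
  rw [hsum]
  refine (norm_sub_le _ _).trans ?_
  rw [add_mul, one_mul]
  exact add_le_add (hint z hz 1 zero_le_one le_rfl) h2

lemma hardySq_add_le {f g : ℂ → ℂ} (hf : DifferentiableOn ℂ f rightHalfPlane)
    (hg : DifferentiableOn ℂ g rightHalfPlane) {M N : ℝ} (hM : 0 ≤ M) (hN : 0 ≤ N)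
    (h₁ : hardySq f ≤ ENNReal.ofReal (M ^ 2)) (h₂ : hardySq g ≤ ENNReal.ofReal (N ^ 2)) :
    hardySq (f + g) ≤ ENNReal.ofReal ((M + N) ^ 2) := by
  refine iSup₂_le fun x hx => ?_
  have e₁ := (lineIntegral_le_hardySq f hx).trans h₁
  have e₂ := (lineIntegral_le_hardySq g hx).trans h₂
  rw [lineIntegral_eq, ENNReal.ofReal_pow hM, ENNReal.pow_le_pow_left_iff two_ne_zero] at e₁
  rw [lineIntegral_eq, ENNReal.ofReal_pow hN, ENNReal.pow_le_pow_left_iff two_ne_zero] at e₂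
  rw [lineIntegral_eq, ENNReal.ofReal_pow (by positivity), ENNReal.pow_le_pow_left_iff two_ne_zero,
    ENNReal.ofReal_add hM hN]
  have hx' : 0 < (x : ℂ).re := by simpa using hx
  exact (eLpNorm_add_le (continuousOn_line hf hx').aestronglyMeasurable
    (continuousOn_line hg hx').aestronglyMeasurable (by norm_num)).trans (add_le_add e₁ e₂)

lemma hardySq_smul (c : ℂ) (f : ℂ → ℂ) : hardySq (c • f) = ‖c‖ₑ ^ 2 * hardySq f := by
  simp only [hardySq, ENNReal.mul_iSup]
  refine iSup_congr fun x => iSup_congr fun _ => ?_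
  simp only [lineIntegral_eq, ← mul_pow]
  congr 1
  exact eLpNorm_const_smul c (fun y : ℝ => f (x + y * I)) 2 volume

/-- Membership in `H²(ℂ₊)`: `f` is analytic on `ℂ₊` and its Hardy norm is finite. A function on
`ℂ₊` is represented by its extension by zero to `ℂ`, so that two members are equal exactly when
they agree on `ℂ₊`. -/
structure MemHardy (f : ℂ → ℂ) : Prop where
  differentiableOn : DifferentiableOn ℂ f rightHalfPlane
  finite : hardySq f < ∞
  eq_zero : ∀ w ∉ rightHalfPlane, f w = 0

lemma MemHardy.le_toReal {f : ℂ → ℂ} (hf : MemHardy f) :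
    hardySq f ≤ ENNReal.ofReal (√(hardySq f).toReal ^ 2) := by
  rw [Real.sq_sqrt ENNReal.toReal_nonneg, ENNReal.ofReal_toReal hf.finite.ne]

lemma MemHardy.add {f g : ℂ → ℂ} (hf : MemHardy f) (hg : MemHardy g) : MemHardy (f + g) where
  differentiableOn := hf.differentiableOn.add hg.differentiableOn
  finite := (hardySq_add_le hf.differentiableOn hg.differentiableOn (Real.sqrt_nonneg _)
    (Real.sqrt_nonneg _) hf.le_toReal hg.le_toReal).trans_lt ENNReal.ofReal_lt_top
  eq_zero w hw := by simp [hf.eq_zero w hw, hg.eq_zero w hw]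

lemma MemHardy.smul (c : ℂ) {f : ℂ → ℂ} (hf : MemHardy f) : MemHardy (c • f) where
  differentiableOn := hf.differentiableOn.const_smul c
  finite := by
    rw [hardySq_smul]
    exact ENNReal.mul_lt_top (by finiteness) hf.finite
  eq_zero w hw := by simp [hf.eq_zero w hw]

lemma hardySq_zero : hardySq (0 : ℂ → ℂ) = 0 := by simp [hardySq, lineIntegral]

/-- The Hardy space `H²(ℂ₊)` of the open right half-plane. -/
structure HardySpace where
  /-- The underlying function. -/
  toFun : ℂ → ℂ
  memHardy : MemHardy toFun

namespace HardySpace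

instance : CoeFun HardySpace fun _ => ℂ → ℂ := ⟨toFun⟩

lemma toFun_injective : Function.Injective toFun := fun ⟨_, _⟩ ⟨_, _⟩ h => by congr

@[ext] lemma ext {f g : HardySpace} (h : ∀ w ∈ rightHalfPlane, f w = g w) : f = g := by
  refine toFun_injective (funext fun w => ?_)
  by_cases hw : w ∈ rightHalfPlane
  · exact h w hw
  · exact (f.memHardy.eq_zero w hw).trans (g.memHardy.eq_zero w hw).symm

instance : Zero HardySpace :=
  ⟨⟨0, differentiableOn_const 0, by simp [hardySq_zero], fun _ _ => rfl⟩⟩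

instance : Add HardySpace := ⟨fun f g => ⟨f.toFun + g.toFun, f.memHardy.add g.memHardy⟩⟩

instance : SMul ℂ HardySpace := ⟨fun c f => ⟨c • f.toFun, f.memHardy.smul c⟩⟩

instance : Neg HardySpace :=
  ⟨fun f => ⟨-f.toFun, by simpa using f.memHardy.smul (-1)⟩⟩

instance : Sub HardySpace :=
  ⟨fun f g => ⟨f.toFun - g.toFun, by
    simpa [sub_eq_add_neg] using f.memHardy.add (g.memHardy.smul (-1))⟩⟩

instance : SMul ℕ HardySpace :=
  ⟨fun n f => ⟨n • f.toFun, by simpa [Nat.cast_smul_eq_nsmul] using f.memHardy.smul (n : ℂ)⟩⟩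

instance : SMul ℤ HardySpace :=
  ⟨fun n f => ⟨n • f.toFun, by simpa [Int.cast_smul_eq_zsmul] using f.memHardy.smul (n : ℂ)⟩⟩

instance : AddCommGroup HardySpace :=
  toFun_injective.addCommGroup toFun rfl (fun _ _ => rfl) (fun _ => rfl) (fun _ _ => rfl)
    (fun _ _ => rfl) (fun _ _ => rfl)

instance : Module ℂ HardySpace :=
  toFun_injective.module ℂ
    { toFun := toFun, map_zero' := rfl, map_add' := fun _ _ => rfl } fun _ _ => rfl

@[simp] lemma add_apply (f g : HardySpace) (w : ℂ) : (f + g) w = f w + g w := rfl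

@[simp] lemma sub_apply (f g : HardySpace) (w : ℂ) : (f - g) w = f w - g w := rfl

@[simp] lemma neg_apply (f : HardySpace) (w : ℂ) : (-f) w = -f w := rfl

@[simp] lemma zero_apply (w : ℂ) : (0 : HardySpace) w = 0 := rfl

@[simp] lemma smul_apply (c : ℂ) (f : HardySpace) (w : ℂ) : (c • f) w = c * f w := rfl

/-- `‖f‖² = sup_{0 < x < ∞} ∫ |f(x + iy)|² dy`. -/
noncomputable instance : Norm HardySpace := ⟨fun f => √(hardySq f).toReal⟩

lemma norm_def (f : HardySpace) : ‖f‖ = √(hardySq f).toReal := rfl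

lemma norm_nonneg' (f : HardySpace) : 0 ≤ ‖f‖ := Real.sqrt_nonneg _

lemma ofReal_norm_sq (f : HardySpace) : ENNReal.ofReal (‖f‖ ^ 2) = hardySq f := by
  rw [norm_def, Real.sq_sqrt ENNReal.toReal_nonneg, ENNReal.ofReal_toReal f.memHardy.finite.ne]

lemma norm_le_of_hardySq_le {f : HardySpace} {N : ℝ} (hN : 0 ≤ N)
    (h : hardySq f ≤ ENNReal.ofReal (N ^ 2)) : ‖f‖ ≤ N :=
  Real.sqrt_le_iff.2 ⟨hN, ENNReal.toReal_le_of_le_ofReal (sq_nonneg N) h⟩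

lemma norm_smul' (c : ℂ) (f : HardySpace) : ‖c • f‖ = ‖c‖ * ‖f‖ := by
  have : hardySq (c • f : HardySpace) = ‖c‖ₑ ^ 2 * hardySq f := hardySq_smul c f
  rw [norm_def, norm_def, this, ENNReal.toReal_mul, Real.sqrt_mul ENNReal.toReal_nonneg]
  simp

lemma norm_eval_le' (f : HardySpace) {N : ℝ} (hN : 0 < N) (h : ‖f‖ ≤ N) {w : ℂ} (hw : 0 < w.re) :
    ‖f w‖ ≤ (1 + 2 / w.re) * N := by
  refine norm_apply_le f.memHardy.differentiableOn hN ?_ hw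
  rw [← ofReal_norm_sq]
  exact ENNReal.ofReal_le_ofReal (pow_le_pow_left₀ f.norm_nonneg' h 2)

noncomputable instance : NormedAddCommGroup HardySpace :=
  AddGroupNorm.toNormedAddCommGroup
    { toFun := fun f => ‖f‖
      map_zero' := by
        have : hardySq (0 : HardySpace) = 0 := hardySq_zero
        simp [norm_def, this]
      add_le' := fun f g => norm_le_of_hardySq_le
        (add_nonneg f.norm_nonneg' g.norm_nonneg')
        (hardySq_add_le f.memHardy.differentiableOn g.memHardy.differentiableOn f.norm_nonneg'
          g.norm_nonneg' f.ofReal_norm_sq.ge g.ofReal_norm_sq.ge)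
      neg' := fun f => by simpa using norm_smul' (-1) f
      eq_zero_of_map_eq_zero' := fun f hf => by
        ext w hw
        have hw' : 0 < w.re := hw
        have hlim : Tendsto (fun N : ℝ => (1 + 2 / w.re) * N) (𝓝[>] 0) (𝓝 0) :=
          tendsto_nhdsWithin_of_tendsto_nhds
            (Continuous.tendsto' (by fun_prop) _ _ (by simp))
        have hle : ‖f w‖ ≤ 0 := ge_of_tendsto hlim (by
          filter_upwards [self_mem_nhdsWithin] with N hN
          have hN' : (0 : ℝ) < N := hN
          exact norm_eval_le' f hN' ((le_of_eq hf).trans hN'.le) hw')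
        simpa using hle }

noncomputable instance : NormedSpace ℂ HardySpace := ⟨fun c f => (norm_smul' c f).le⟩

lemma norm_eval_le (f : HardySpace) {w : ℂ} (hw : 0 < w.re) :
    ‖f w‖ ≤ (1 + 2 / w.re) * ‖f‖ := by
  rcases eq_or_ne f 0 with rfl | hf
  · simp
  · exact norm_eval_le' f (norm_pos_iff.2 hf) le_rfl hw

lemma parallelogram_le (f g : HardySpace) :
    ‖f + g‖ ^ 2 + ‖f - g‖ ^ 2 ≤ 2 * (‖f‖ ^ 2 + ‖g‖ ^ 2) := by
  have hpt : ∀ x : ℝ, 0 < x → lineIntegral (f + g : HardySpace) x +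
      lineIntegral (f - g : HardySpace) x = 2 * (lineIntegral f x + lineIntegral g x) :=
    fun x hx => by
    have hm : ∀ h : HardySpace, Measurable fun y : ℝ => ‖h (x + y * I)‖ₑ ^ 2 := fun h =>
      (continuousOn_line h.memHardy.differentiableOn
        (by simpa using hx)).enorm.measurable.pow_const 2
    simp only [lineIntegral]
    rw [← lintegral_add_left (hm _), ← lintegral_add_left (hm _),
      ← lintegral_const_mul' _ _ ENNReal.ofNat_ne_top]
    refine lintegral_congr fun y => ?_
    have hpar := parallelogram_law_with_norm ℝ (f (x + y * I)) (g (x + y * I))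
    simp only [← ofReal_norm, ← ENNReal.ofReal_pow (norm_nonneg _), add_apply, sub_apply]
    rw [← ENNReal.ofReal_add (by positivity) (by positivity),
      ← ENNReal.ofReal_add (by positivity) (by positivity), ← ENNReal.ofReal_ofNat,
      ← ENNReal.ofReal_mul (by positivity)]
    congr 1
  rw [← ENNReal.ofReal_le_ofReal_iff (by positivity), ENNReal.ofReal_add (by positivity)
    (by positivity), ENNReal.ofReal_mul (by positivity), ENNReal.ofReal_add (by positivity)
    (by positivity), ENNReal.ofReal_ofNat]
  simp only [ofReal_norm_sq]
  conv_lhs => simp only [hardySq]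
  refine ENNReal.biSup_add_biSup_le' (p := fun x : ℝ => 0 < x) (q := fun x : ℝ => 0 < x)
    ⟨1, one_pos⟩ ⟨1, one_pos⟩ fun x hx x' hx' => ?_
  have hmin : 0 < min x x' := lt_min hx hx'
  calc _ ≤ lineIntegral (f + g : HardySpace) (min x x') +
        lineIntegral (f - g : HardySpace) (min x x') :=
      add_le_add
        (lineIntegral_antitone (memHardy _).differentiableOn (memHardy _).finite hmin
          (min_le_left _ _))
        (lineIntegral_antitone (memHardy _).differentiableOn (memHardy _).finite hmin
          (min_le_right _ _))
    _ = 2 * (lineIntegral f (min x x') + lineIntegral g (min x x')) := hpt _ hmin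
    _ ≤ _ := by gcongr <;> exact lineIntegral_le_hardySq _ hmin

/-- The inner product of `H²(ℂ₊)`: the one that induces the Hardy norm. -/
noncomputable instance : InnerProductSpace ℂ HardySpace :=
  InnerProductSpace.ofNorm ℂ fun f g => by
    have h₁ := parallelogram_le f g
    have h₂ := parallelogram_le (f + g) (f - g)
    have e₁ : f + g + (f - g) = (2 : ℂ) • f := by rw [two_smul]; abel
    have e₂ : f + g - (f - g) = (2 : ℂ) • g := by rw [two_smul]; abel
    rw [e₁, e₂, norm_smul, norm_smul, Complex.norm_ofNat] at h₂
    nlinarith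

instance : CompleteSpace HardySpace := by
  apply Metric.complete_of_cauchySeq_tendsto
  intro u hu
  replace hu := Metric.cauchySeq_iff.1 hu
  have hpt : ∀ w : ℂ, 0 < w.re → ∀ m n, ‖u m w - u n w‖ ≤ (1 + 2 / w.re) * dist (u m) (u n) :=
    fun w hw m n => by
      rw [dist_eq_norm]
      exact norm_eval_le (u m - u n) hw
  have hex : ∀ w : ℂ, ∃ l : ℂ, Tendsto (fun n => u n w) atTop (𝓝 l) := fun w => by
    by_cases hw : 0 < w.re
    · refine cauchySeq_tendsto_of_complete (Metric.cauchySeq_iff.2 fun ε hε => ?_)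
      have hc : 0 < 1 + 2 / w.re := by positivity
      obtain ⟨N, hN⟩ := hu (ε / (1 + 2 / w.re)) (by positivity)
      refine ⟨N, fun m hm n hn => ?_⟩
      rw [dist_eq_norm]
      refine (hpt w hw m n).trans_lt ?_
      rw [mul_comm]
      exact (lt_div_iff₀ hc).1 (hN m hm n hn)
    · exact ⟨0, by simp [fun n => (u n).memHardy.eq_zero w hw]⟩
  choose f hf using hex
  have hunif : TendstoLocallyUniformlyOn (fun n => (u n : ℂ → ℂ)) f atTop rightHalfPlane := by
    rw [Metric.tendstoLocallyUniformlyOn_iff]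
    intro ε hε z hz
    have hz' : 0 < z.re := hz
    have hc : 0 < 1 + 2 / (z.re / 2) := by positivity
    refine ⟨{w | z.re / 2 < w.re}, mem_nhdsWithin_of_mem_nhds
      ((isOpen_lt continuous_const continuous_re).mem_nhds (by
        change z.re / 2 < z.re; linarith)), ?_⟩
    obtain ⟨N, hN⟩ := hu (ε / 2 / (1 + 2 / (z.re / 2))) (by positivity)
    filter_upwards [eventually_ge_atTop N] with n hn w hw
    have hw' : z.re / 2 < w.re := hw
    have hw0 : 0 < w.re := by linarith
    have hle : ‖f w - u n w‖ ≤ ε / 2 := by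
      refine le_of_tendsto ((hf w).sub_const (u n w)).norm ?_
      filter_upwards [eventually_ge_atTop N] with m hm
      refine (hpt w hw0 m n).trans ?_
      have h1 : 1 + 2 / w.re ≤ 1 + 2 / (z.re / 2) := by gcongr
      calc _ ≤ (1 + 2 / (z.re / 2)) * (ε / 2 / (1 + 2 / (z.re / 2))) :=
            mul_le_mul h1 (hN m hm n hn).le dist_nonneg hc.le
        _ = ε / 2 := by field_simp
    rw [dist_eq_norm]
    linarith
  have hdiff : DifferentiableOn ℂ f rightHalfPlane :=
    hunif.differentiableOn (Eventually.of_forall fun n => (u n).memHardy.differentiableOn)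
      isOpen_rightHalfPlane
  have hzero : ∀ w ∉ rightHalfPlane, f w = 0 := fun w hw =>
    tendsto_nhds_unique (hf w) (by simp [fun n => (u n).memHardy.eq_zero w hw])
  have hclose : ∀ ε : ℝ, 0 < ε → ∃ N, ∀ n ≥ N, hardySq (u n - f) ≤ ENNReal.ofReal (ε ^ 2) :=
    fun ε hε => by
    obtain ⟨N, hN⟩ := hu ε hε
    refine ⟨N, fun n hn => iSup₂_le fun x hx => ?_⟩
    have hm : ∀ m, Measurable fun y : ℝ => ‖(u n - u m) (x + y * I)‖ₑ ^ 2 := fun m =>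
      (continuousOn_line (u n - u m).memHardy.differentiableOn
        (by simpa using hx)).enorm.measurable.pow_const 2
    calc lineIntegral (u n - f) x
        = ∫⁻ y : ℝ, liminf (fun m => ‖(u n - u m) (x + y * I)‖ₑ ^ 2) atTop := by
          refine lintegral_congr fun y => (Tendsto.liminf_eq ?_).symm
          exact ((ENNReal.continuous_pow 2).comp continuous_enorm).continuousAt.tendsto.comp
            ((hf (x + y * I)).const_sub (u n (x + y * I)))
      _ ≤ liminf (fun m => lineIntegral (u n - u m : HardySpace) x) atTop :=
          lintegral_liminf_le hm
      _ ≤ ENNReal.ofReal (ε ^ 2) := by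
          refine liminf_le_of_frequently_le' (Eventually.frequently ?_)
          filter_upwards [eventually_ge_atTop N] with m hm
          refine (lineIntegral_le_hardySq _ hx).trans ?_
          rw [← ofReal_norm_sq, ← dist_eq_norm]
          exact ENNReal.ofReal_le_ofReal (pow_le_pow_left₀ dist_nonneg (hN n hn m hm).le 2)
  have hmem : MemHardy f := by
    obtain ⟨N, hN⟩ := hclose 1 one_pos
    have h1 : MemHardy (u N - f) :=
      ⟨(u N).memHardy.differentiableOn.sub hdiff, (hN N le_rfl).trans_lt ENNReal.ofReal_lt_top,
        fun w hw => by simp [hzero w hw, (u N).memHardy.eq_zero w hw]⟩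
    have h2 := (u N).memHardy.add (h1.smul (-1))
    simpa using h2
  let F : HardySpace := ⟨f, hmem⟩
  have hF : ∀ n, (u n - F).toFun = (u n).toFun - f := fun n => rfl
  refine ⟨F, Metric.tendsto_atTop.2 fun ε hε => ?_⟩
  obtain ⟨N, hN⟩ := hclose (ε / 2) (half_pos hε)
  refine ⟨N, fun n hn => ?_⟩
  rw [dist_eq_norm]
  have hle : ‖u n - F‖ ≤ ε / 2 := norm_le_of_hardySq_le (half_pos hε).le (by
    rw [hF]
    exact hN n hn)
  exact hle.trans_lt (half_lt_self hε)

end HardySpace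

/-- `f ∘ φ` on `ℂ₊`, extended by zero, for the affine map `φ(w) = a w + b`. -/
noncomputable def affineComp (a : ℝ) (b : ℂ) (f : ℂ → ℂ) : ℂ → ℂ :=
  rightHalfPlane.indicator fun w => f (a * w + b)

lemma affine_mem {a : ℝ} {b : ℂ} (ha : 0 < a) (hb : 0 ≤ b.re) {w : ℂ} (hw : w ∈ rightHalfPlane) :
    a * w + b ∈ rightHalfPlane := by
  have hw' : 0 < w.re := hw
  simpa [rightHalfPlane] using add_pos_of_pos_of_nonneg (mul_pos ha hw') hb

lemma hardySq_affineComp_le {a : ℝ} {b : ℂ} (ha : 0 < a) (hb : 0 ≤ b.re) (f : ℂ → ℂ) :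
    hardySq (affineComp a b f) ≤ ENNReal.ofReal a⁻¹ * hardySq f := by
  refine iSup₂_le fun x hx => ?_
  have key : lineIntegral (affineComp a b f) x =
      ENNReal.ofReal a⁻¹ * lineIntegral f (a * x + b.re) := by
    have h1 : ∀ y : ℝ, affineComp a b f (x + y * I) =
        f ((a * x + b.re : ℝ) + ((a * y + b.im : ℝ) : ℂ) * I) := fun y => by
      rw [affineComp, Set.indicator_of_mem (by simpa [rightHalfPlane] using hx)]
      congr 1
      apply Complex.ext <;> simp
    simp only [lineIntegral, h1]
    rw [← lintegral_add_right_eq_self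
      (fun y : ℝ => ‖f ((a * x + b.re : ℝ) + (y : ℂ) * I)‖ₑ ^ 2) b.im]
    have h2 := (Homeomorph.mulLeft₀ a ha.ne').measurableEmbedding.lintegral_map
      (μ := (volume : Measure ℝ))
      (fun y : ℝ => ‖f ((a * x + b.re : ℝ) + ((y + b.im : ℝ) : ℂ) * I)‖ₑ ^ 2)
    rw [Homeomorph.coe_mulLeft₀, Real.map_volume_mul_left ha.ne', lintegral_smul_measure,
      abs_of_pos (inv_pos.2 ha), smul_eq_mul] at h2
    exact h2.symm
  rw [key]
  gcongr
  exact lineIntegral_le_hardySq f (by positivity)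

lemma memHardy_affineComp {a : ℝ} {b : ℂ} (ha : 0 < a) (hb : 0 ≤ b.re) {f : ℂ → ℂ}
    (hf : MemHardy f) : MemHardy (affineComp a b f) where
  differentiableOn := by
    refine (hf.differentiableOn.comp (t := rightHalfPlane) (s := rightHalfPlane)
      (f := fun w : ℂ => a * w + b) (by fun_prop) fun w hw => affine_mem ha hb hw).congr
      fun w hw => ?_
    simp [affineComp, hw]
  finite := (hardySq_affineComp_le ha hb f).trans_lt
    (ENNReal.mul_lt_top ENNReal.ofReal_lt_top hf.finite)
  eq_zero w hw := by simp [affineComp, hw]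

/-- The composition operator `C_φ f = f ∘ φ` on `H²(ℂ₊)` with symbol `φ(w) = a w + b`,
where `a > 0` and `Re b ≥ 0`. -/
noncomputable def compositionOperator (a : ℝ) (b : ℂ) (ha : 0 < a) (hb : 0 ≤ b.re) :
    HardySpace →L[ℂ] HardySpace :=
  LinearMap.mkContinuous
    { toFun := fun f => (⟨affineComp a b f, memHardy_affineComp ha hb f.memHardy⟩ : HardySpace)
      map_add' := fun f g => by
        ext w hw
        simp [affineComp, hw]
      map_smul' := fun c f => by
        ext w hw
        simp [affineComp, hw] }
    √a⁻¹ fun f => by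
      refine HardySpace.norm_le_of_hardySq_le (by positivity)
        ((hardySq_affineComp_le ha hb f).trans (le_of_eq ?_))
      rw [mul_pow, Real.sq_sqrt (by positivity), ENNReal.ofReal_mul (by positivity),
        HardySpace.ofReal_norm_sq]

lemma compositionOperator_apply {a : ℝ} {b : ℂ} (ha : 0 < a) (hb : 0 ≤ b.re) (f : HardySpace)
    {w : ℂ} (hw : w ∈ rightHalfPlane) : compositionOperator a b ha hb f w = f (a * w + b) :=
  Set.indicator_of_mem hw fun w => f (a * w + b)

lemma re_dual_nonneg {a : ℝ} {b : ℂ} (ha : 0 < a) (hb : 0 ≤ b.re) :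
    0 ≤ ((a⁻¹ : ℝ) * conj b).re := by
  simpa using mul_nonneg (inv_pos.2 ha).le hb

section Operators

variable {H : Type*} [NormedAddCommGroup H] [InnerProductSpace ℂ H]

/-- A conjugation: a conjugate-linear, isometric (`⟨C f, C g⟩ = ⟨g, f⟩`), involutive map. -/
structure IsConjugation (C : H →ₗ⋆[ℂ] H) : Prop where
  isometric : ∀ f g : H, inner ℂ (C f) (C g) = inner ℂ g f
  involutive : ∀ f : H, C (C f) = f

/-- `T` is complex symmetric: `C T = T* C` for some conjugation `C`. -/
def IsComplexSymmetric [CompleteSpace H] (T : H →L[ℂ] H) : Prop :=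
  ∃ C : H →ₗ⋆[ℂ] H, IsConjugation C ∧ ∀ f : H, C (T f) = ContinuousLinearMap.adjoint T (C f)

/-- `T` is cyclic: for some vector `f`, the linear span of the orbit `(Tⁿ f)` is dense. -/
def IsCyclicOperator (T : H →L[ℂ] H) : Prop :=
  ∃ f : H, Dense (Submodule.span ℂ (Set.range fun n : ℕ => (T ^ n) f) : Set H)

end Operators

end HalfPlaneHardy

namespace HalfPlaneHardy

open Complex MeasureTheory Filter Topology
open scoped ENNReal ComplexConjugate

/-! Everything is read off from the reproducing kernels K_u(w) = 1 / (2π(w + ū)), which span a dense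
subspace. With φ(w) = aw + b and ψ(w) = a⁻¹w + a⁻¹b̄, a direct computation gives C_φ K_u = a⁻¹
K_{ψ(u)}, and the reproducing property gives C_φ* K_u = K_{φ(u)}. Comparing the two gives C_φ = a⁻¹
C_ψ* (`compositionOperator_eq_smul_adjoint`) and turns normality into the commutation of φ and ψ,
which holds exactly when a = 1 or Re b = 0.

In these two cases a conjugation is obtained by sending K_u to a multiple of K_{m(u)}, where m is an
antiholomorphic involution of ℂ₊ intertwining ψ with φ: complex conjugation if a = 1, and inversion
in a circle about the fixed point of φ otherwise (`isComplexSymmetric_of_total`).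

In the remaining cases cyclicity obstructs complex symmetry, since a conjugation carries cyclic
vectors of T to cyclic vectors of T*. For a > 1 the points ψⁿ(u) accumulate at the fixed point of ψ
inside ℂ₊, so a suitable kernel is cyclic by the identity theorem. For a < 1 the adjoint has the
independent fixed vectors (w + c)^(-1-iτ) for two values of τ, so C_φ is not cyclic. As the adjoint
exchanges the two types up to a scalar, neither type is complex symmetric.

The analytic input is the reproducing property `inner_szegoKernel`: the inner product, given by
polarization of a supremum norm, is a limit of integrals over vertical lines, and these are
evaluated by Cauchy's theorem. -/

/-! ### Poisson-type integrals and a membership criterion. -/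

lemma integrable_inv_sq_add_sq {d : ℝ} (hd : 0 < d) (e : ℝ) :
    Integrable fun y : ℝ => (d ^ 2 + (y + e) ^ 2)⁻¹ := by
  have h := (((integrable_inv_one_add_sq.comp_div hd.ne').comp_add_right e).const_mul (d ^ 2)⁻¹)
  refine h.congr (Eventually.of_forall fun y => ?_)
  dsimp only
  rw [← mul_inv]
  congr 1
  field_simp

lemma integral_inv_sq_add_sq {d : ℝ} (hd : 0 < d) (e : ℝ) :
    ∫ y : ℝ, (d ^ 2 + (y + e) ^ 2)⁻¹ = Real.pi / d := by
  have h : ∀ y : ℝ, (d ^ 2 + (y + e) ^ 2)⁻¹ = (d ^ 2)⁻¹ * (1 + ((y + e) / d) ^ 2)⁻¹ := fun y => by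
    rw [← mul_inv]
    congr 1
    field_simp
  simp only [h]
  rw [integral_const_mul, integral_add_right_eq_self (fun y : ℝ => (1 + (y / d) ^ 2)⁻¹) e,
    Measure.integral_comp_div (fun y : ℝ => (1 + y ^ 2)⁻¹) d, integral_univ_inv_one_add_sq,
    abs_of_pos hd, smul_eq_mul]
  field_simp

lemma add_ne_zero_of_re_pos {z w : ℂ} (hz : 0 < z.re) (hw : 0 < w.re) : z + w ≠ 0 := fun h => by
  have := congrArg re h
  simp at this
  linarith

/-- A function that is analytic on `ℂ₊` and decays like `1 / |w + d|` defines a member of the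
Hardy space. -/
lemma memHardy_indicator {g : ℂ → ℂ} (hg : DifferentiableOn ℂ g rightHalfPlane) {d : ℂ}
    (hd : 0 < d.re) {M : ℝ} (h : ∀ w ∈ rightHalfPlane, ‖g w‖ ≤ M / ‖w + d‖) :
    MemHardy (rightHalfPlane.indicator g) where
  differentiableOn := hg.congr fun w hw => Set.indicator_of_mem hw g
  finite := by
    refine (iSup₂_le fun x hx => ?_ :
      _ ≤ ENNReal.ofReal (M ^ 2 * (Real.pi / d.re))).trans_lt ENNReal.ofReal_lt_top
    rw [← integral_inv_sq_add_sq hd d.im, ← integral_const_mul,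
      ofReal_integral_eq_lintegral_ofReal ((integrable_inv_sq_add_sq hd d.im).const_mul _)
        (Eventually.of_forall fun y => by positivity)]
    refine lintegral_mono fun y => ?_
    have hw : (x + y * I : ℂ) ∈ rightHalfPlane := by simpa [rightHalfPlane] using hx
    rw [Set.indicator_of_mem hw, ← ofReal_norm, ← ENNReal.ofReal_pow (norm_nonneg _)]
    refine ENNReal.ofReal_le_ofReal ((pow_le_pow_left₀ (norm_nonneg _) (h _ hw) 2).trans ?_)
    rw [div_pow, div_eq_mul_inv, Complex.sq_norm, normSq_apply]
    -- Dropping x from (x + Re d)² ≥ (Re d)² makes the bound uniform in x.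
    refine mul_le_mul_of_nonneg_left (inv_anti₀ (by positivity) ?_) (sq_nonneg M)
    simp only [add_re, ofReal_re, mul_re, I_re, mul_zero, ofReal_im, I_im, mul_one, sub_self,
      add_zero, add_im, mul_im, zero_add]
    nlinarith
  eq_zero w hw := Set.indicator_of_notMem hw g

/-! ### The inner product as a limit of integrals over vertical lines. -/

namespace HardySpace

/-- The means decrease in x, so their supremum is their limit at the boundary. This makes the norm,
and by polarization the inner product, computable. -/
lemma tendsto_lineIntegral (f : HardySpace) :
    Tendsto (fun x : ℝ => lineIntegral f x) (𝓝[>] 0) (𝓝 (hardySq f)) := by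
  refine tendsto_order.2 ⟨fun a ha => ?_, fun a ha => ?_⟩
  · obtain ⟨x₀, h⟩ := lt_iSup_iff.1 ha
    obtain ⟨hx₀, h⟩ := lt_iSup_iff.1 h
    filter_upwards [Ioo_mem_nhdsGT hx₀] with x hx
    exact h.trans_le
      (lineIntegral_antitone f.memHardy.differentiableOn f.memHardy.finite hx.1 hx.2.le)
  · filter_upwards [self_mem_nhdsWithin] with x hx
    exact (lineIntegral_le_hardySq f hx).trans_lt ha

lemma continuous_line (f : HardySpace) {x : ℝ} (hx : 0 < x) :
    Continuous fun y : ℝ => f (x + y * I) :=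
  continuousOn_line f.memHardy.differentiableOn (by simpa using hx)

lemma integrable_norm_sq (f : HardySpace) {x : ℝ} (hx : 0 < x) :
    Integrable fun y : ℝ => ‖f (x + y * I)‖ ^ 2 := by
  refine ⟨((f.continuous_line hx).norm.pow 2).aestronglyMeasurable, ?_⟩
  refine lt_of_eq_of_lt ?_ ((lineIntegral_le_hardySq f hx).trans_lt f.memHardy.finite)
  exact lintegral_congr fun y => by simp

lemma integral_norm_sq (f : HardySpace) {x : ℝ} (hx : 0 < x) :
    ∫ y : ℝ, ‖f (x + y * I)‖ ^ 2 = (lineIntegral f x).toReal := by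
  rw [integral_eq_lintegral_of_nonneg_ae (Eventually.of_forall fun _ => by positivity)
    (integrable_norm_sq f hx).aestronglyMeasurable]
  congr 1
  exact lintegral_congr fun y => by rw [ENNReal.ofReal_pow (norm_nonneg _), ofReal_norm]

lemma norm_sq_eq (f : HardySpace) : ‖f‖ ^ 2 = (hardySq f).toReal := by
  rw [norm_def, Real.sq_sqrt ENNReal.toReal_nonneg]

lemma integral_norm_sq_le (f : HardySpace) {x : ℝ} (hx : 0 < x) :
    ∫ y : ℝ, ‖f (x + y * I)‖ ^ 2 ≤ ‖f‖ ^ 2 := by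
  rw [integral_norm_sq f hx, norm_sq_eq]
  exact ENNReal.toReal_mono f.memHardy.finite.ne (lineIntegral_le_hardySq f hx)

lemma tendsto_integral_norm_sq (f : HardySpace) :
    Tendsto (fun x : ℝ => ∫ y : ℝ, ‖f (x + y * I)‖ ^ 2) (𝓝[>] 0) (𝓝 (‖f‖ ^ 2)) := by
  rw [norm_sq_eq]
  refine ((ENNReal.tendsto_toReal f.memHardy.finite.ne).comp f.tendsto_lineIntegral).congr' ?_
  filter_upwards [self_mem_nhdsWithin] with x hx
  exact (integral_norm_sq f hx).symm

/-- Pointwise polarization, in the same pattern as the inner product that `InnerProductSpace.ofNorm`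
builds from the norm. -/
lemma inner_line_eq (g f : HardySpace) (x y : ℝ) :
    conj (g (x + y * I)) * f (x + y * I) =
      (((‖(g + f) (x + y * I)‖ ^ 2 : ℝ) : ℂ) - ((‖(g - f) (x + y * I)‖ ^ 2 : ℝ) : ℂ) +
        (((‖(g - I • f) (x + y * I)‖ ^ 2 : ℝ) : ℂ) -
          ((‖(g + I • f) (x + y * I)‖ ^ 2 : ℝ) : ℂ)) * I) / 4 := by
  have := inner_eq_sum_norm_sq_div_four (𝕜 := ℂ) (g (x + y * I)) (f (x + y * I))
  rw [RCLike.inner_apply, mul_comm] at this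
  simpa using this

lemma integrable_inner_line (g f : HardySpace) {x : ℝ} (hx : 0 < x) :
    Integrable fun y : ℝ => conj (g (x + y * I)) * f (x + y * I) := by
  simp only [inner_line_eq]
  exact (((integrable_norm_sq _ hx).ofReal.sub (integrable_norm_sq _ hx).ofReal).add
    (((integrable_norm_sq _ hx).ofReal.sub (integrable_norm_sq _ hx).ofReal).mul_const I)).div_const 4

/-- The inner product is the limit of the `L²` inner products on vertical lines. -/
lemma tendsto_integral_inner (g f : HardySpace) :
    Tendsto (fun x : ℝ => ∫ y : ℝ, conj (g (x + y * I)) * f (x + y * I)) (𝓝[>] 0)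
      (𝓝 (inner ℂ g f)) := by
  have ht : ∀ h : HardySpace, Tendsto (fun x : ℝ => ((∫ y : ℝ, ‖h (x + y * I)‖ ^ 2 : ℝ) : ℂ))
      (𝓝[>] 0) (𝓝 ((‖h‖ : ℂ) ^ 2)) := fun h => by
    have := (continuous_ofReal.tendsto _).comp h.tendsto_integral_norm_sq
    rwa [ofReal_pow] at this
  rw [inner_eq_sum_norm_sq_div_four (𝕜 := ℂ) g f]
  refine ((((ht (g + f)).sub (ht (g - f))).add
    (((ht (g - I • f)).sub (ht (g + I • f))).mul_const I)).div_const 4).congr' ?_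
  filter_upwards [self_mem_nhdsWithin] with x hx
  have hi : ∀ h : HardySpace, Integrable fun y : ℝ => ((‖h (x + y * I)‖ ^ 2 : ℝ) : ℂ) :=
    fun h => (integrable_norm_sq h hx).ofReal
  have hs : ∀ h k : HardySpace, Integrable fun y : ℝ =>
      ((‖h (x + y * I)‖ ^ 2 : ℝ) : ℂ) - ((‖k (x + y * I)‖ ^ 2 : ℝ) : ℂ) :=
    fun h k => (hi h).sub (hi k)
  simp only [inner_line_eq]
  rw [integral_div, integral_add (hs _ _) ((hs _ _).mul_const I),
    integral_sub (hi _) (hi _), integral_mul_const, integral_sub (hi _) (hi _)]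
  have e : ∀ h : HardySpace, ∫ y : ℝ, ((‖h (x + y * I)‖ ^ 2 : ℝ) : ℂ) =
      ((∫ y : ℝ, ‖h (x + y * I)‖ ^ 2 : ℝ) : ℂ) := fun h => integral_ofReal
  rw [e, e, e, e]

/-! ### Cauchy's theorem on a vertical line. -/

/-- Cauchy's theorem for `g(z) / (z - v)`, where `g` is in the Hardy space and vanishes at `v`. -/
lemma tendsto_integral_line_of_sub_mul_eq (g : HardySpace) {q : ℂ → ℂ}
    (hq : DifferentiableOn ℂ q rightHalfPlane) {v : ℂ}
    (h : ∀ z ∈ rightHalfPlane, (z - v) * q z = g z) {x : ℝ} (hx : 0 < x) (hxv : x < v.re) :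
    Tendsto (fun R : ℝ => ∫ y in (-R)..R, q (x + y * I)) atTop (𝓝 0) := by
  set B : ℝ := (1 + 2 / x) * ‖g‖ with hB
  have hB0 : 0 ≤ B := by positivity
  have hgB : ∀ z : ℂ, x ≤ z.re → ‖g z‖ ≤ B := fun z hz => by
    refine (norm_eval_le g (hx.trans_le hz)).trans ?_
    rw [hB]
    gcongr
  have hqc : ∀ s : ℝ, 0 < s → Continuous fun y : ℝ => q (s + y * I) := fun s hs =>
    continuousOn_line hq (by simpa using hs)
  have hmul : ∀ z ∈ rightHalfPlane, ‖z - v‖ * ‖q z‖ = ‖g z‖ := fun z hz => by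
    rw [← norm_mul, h z hz]
  have hhor : ∀ s y r : ℝ, x ≤ s → 0 < r → r ≤ |y - v.im| → ‖q (s + y * I)‖ ≤ B / r :=
    fun s y r hs hr hy => by
    have hz : (s + y * I : ℂ) ∈ rightHalfPlane := by
      simpa [rightHalfPlane] using hx.trans_le hs
    have h1 : r ≤ ‖(s + y * I : ℂ) - v‖ :=
      hy.trans (by simpa using abs_im_le_norm ((s + y * I : ℂ) - v))
    rw [le_div_iff₀ hr, mul_comm]
    exact (mul_le_mul_of_nonneg_right h1 (norm_nonneg _)).trans
      ((hmul _ hz).le.trans (hgB _ (by simpa using hs)))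
  -- The far edge lies at distance t² to the right of v, where ∫ |z - v|⁻² dy = π / t². Weighting
  -- the two factors of g · (z - v)⁻¹ by t in the arithmetic-geometric mean inequality gives a bound
  -- of order 1 / t that does not depend on R.
  have hvert : ∀ t R : ℝ, 0 < t → 0 ≤ R →
      ‖∫ y in (-R)..R, q ((v.re + t ^ 2 : ℝ) + y * I)‖ ≤ (‖g‖ ^ 2 + Real.pi) / (2 * t) :=
    fun t R ht hR => by
    set s : ℝ := v.re + t ^ 2 with hs
    have hs0 : 0 < s := by positivity [hx.trans hxv]
    have ht2 : 0 < t ^ 2 := by positivity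
    have hI := integrable_inv_sq_add_sq ht2 (-v.im)
    have hg := integrable_norm_sq g hs0
    have hsum : Integrable fun y : ℝ => (2 * t)⁻¹ * ‖g (s + y * I)‖ ^ 2 +
        t / 2 * ((t ^ 2) ^ 2 + (y + -v.im) ^ 2)⁻¹ := (hg.const_mul _).add (hI.const_mul _)
    have hpt : ∀ y : ℝ, ‖q (s + y * I)‖ ≤ (2 * t)⁻¹ * ‖g (s + y * I)‖ ^ 2 +
        t / 2 * ((t ^ 2) ^ 2 + (y + -v.im) ^ 2)⁻¹ := fun y => by
      have hz : (s + y * I : ℂ) ∈ rightHalfPlane := by simpa [rightHalfPlane] using hs0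
      have hn : ‖(s + y * I : ℂ) - v‖ ^ 2 = (t ^ 2) ^ 2 + (y + -v.im) ^ 2 := by
        rw [Complex.sq_norm, normSq_apply]
        simp [hs, -ofReal_pow]
        ring
      have hD : 0 < ‖(s + y * I : ℂ) - v‖ := by
        refine norm_pos_iff.2 fun h0 => ?_
        rw [h0, norm_zero] at hn
        nlinarith [sq_nonneg (y + -v.im), pow_pos ht2 2]
      rw [← hn, ← hmul _ hz]
      set D := ‖(s + y * I : ℂ) - v‖
      set Q := ‖q (s + y * I)‖
      have : (2 * t)⁻¹ * (D * Q) ^ 2 + t / 2 * (D ^ 2)⁻¹ - Q =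
          (2 * t)⁻¹ * (D * Q - t / D) ^ 2 := by
        field_simp
        ring
      have h2 : 0 ≤ (2 * t)⁻¹ * (D * Q - t / D) ^ 2 := by positivity
      linarith
    calc _ ≤ ∫ y in (-R)..R, ‖q (s + y * I)‖ :=
          intervalIntegral.norm_integral_le_integral_norm (by linarith)
      _ ≤ ∫ y in (-R)..R, ((2 * t)⁻¹ * ‖g (s + y * I)‖ ^ 2 +
            t / 2 * ((t ^ 2) ^ 2 + (y + -v.im) ^ 2)⁻¹) :=
          intervalIntegral.integral_mono (by linarith)
            ((hqc s hs0).norm.intervalIntegrable _ _) hsum.intervalIntegrable hpt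
      _ ≤ ∫ y : ℝ, ((2 * t)⁻¹ * ‖g (s + y * I)‖ ^ 2 +
            t / 2 * ((t ^ 2) ^ 2 + (y + -v.im) ^ 2)⁻¹) := by
          rw [intervalIntegral.integral_of_le (by linarith)]
          exact setIntegral_le_integral hsum (Eventually.of_forall fun y => by positivity)
      _ = (2 * t)⁻¹ * (∫ y : ℝ, ‖g (s + y * I)‖ ^ 2) + t / 2 * (Real.pi / t ^ 2) := by
          rw [integral_add (hg.const_mul _) (hI.const_mul _), integral_const_mul,
            integral_const_mul, integral_inv_sq_add_sq ht2]
      _ ≤ (2 * t)⁻¹ * ‖g‖ ^ 2 + t / 2 * (Real.pi / t ^ 2) := by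
          gcongr
          exact integral_norm_sq_le g hs0
      _ = _ := by field_simp
  -- Cauchy's theorem on the rectangle x ≤ Re z ≤ Re v + t², |Im z| ≤ |Im v| + r. There is no
  -- residue, as q is analytic at v too. On the horizontal edges |q| ≤ B / r.
  have hrect : ∀ t r : ℝ, 0 < t → 0 < r →
      ‖∫ y in (-(|v.im| + r))..(|v.im| + r), q (x + y * I)‖ ≤
        (‖g‖ ^ 2 + Real.pi) / (2 * t) + 2 * (B * (v.re + t ^ 2 - x) / r) := fun t r ht hr => by
    set R := |v.im| + r with hR
    set s : ℝ := v.re + t ^ 2 with hs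
    have hxs : x ≤ s := by nlinarith
    have hc := Complex.integral_boundary_rect_eq_zero_of_differentiableOn q
      (x + (-R : ℝ) * I) (s + R * I) (hq.mono fun z hz => by
        have := hz.1
        simp only [add_re, ofReal_re, mul_re, I_re, mul_zero, ofReal_im, I_im, mul_one, sub_self,
          add_zero, Set.mem_preimage, Set.uIcc_of_le hxs] at this
        exact hx.trans_le this.1)
    simp only [add_re, ofReal_re, mul_re, I_re, mul_zero, ofReal_im, I_im, mul_one, sub_self,
      add_zero, add_im, mul_im, zero_add, smul_eq_mul] at hc
    have hH : ∀ y : ℝ, r ≤ |y - v.im| → ‖∫ σ in x..s, q (σ + y * I)‖ ≤ B * (s - x) / r :=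
      fun y hy => by
      have := intervalIntegral.norm_integral_le_of_norm_le_const (a := x) (b := s)
        (f := fun σ : ℝ => q (σ + y * I)) (C := B / r) fun σ hσ => by
          rw [Set.uIoc_of_le hxs] at hσ
          exact hhor σ y r hσ.1.le hr hy
      rw [abs_of_nonneg (by linarith)] at this
      exact this.trans (le_of_eq (by ring))
    have h1 := hH (-R) (by
      rw [abs_of_nonpos (by linarith [neg_abs_le v.im])]
      linarith [neg_abs_le v.im])
    have h2 := hH R (by
      rw [abs_of_nonneg (by linarith [le_abs_self v.im])]
      linarith [le_abs_self v.im])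
    have h3 := hvert t R ht (by positivity)
    set X₁ := ∫ σ in x..s, q (σ + (-R : ℝ) * I)
    set X₂ := ∫ σ in x..s, q (σ + R * I)
    set Y₁ := ∫ y in (-R)..R, q (s + y * I)
    set Y₂ := ∫ y in (-R)..R, q (x + y * I)
    have hY : Y₂ = Y₁ - I * (X₁ - X₂) := by linear_combination I * hc - (Y₁ - Y₂) * I_sq
    rw [hY]
    refine (norm_sub_le _ _).trans ?_
    rw [norm_mul, norm_I, one_mul]
    have := norm_sub_le X₁ X₂
    linarith
  rw [Metric.tendsto_atTop]
  intro ε hε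
  set A := ‖g‖ ^ 2 + Real.pi with hA
  have hA0 : 0 < A := by positivity
  -- The far edge is fixed first, so that it contributes ε / 4; then r is taken large enough that
  -- the two horizontal edges contribute at most ε / 4 each.
  set t := 2 * A / ε with ht
  have ht0 : 0 < t := by positivity
  have hE0 : 0 ≤ B * (v.re + t ^ 2 - x) := mul_nonneg hB0 (by nlinarith)
  set E := B * (v.re + t ^ 2 - x)
  refine ⟨|v.im| + (4 * E / ε + 1), fun R hR => ?_⟩
  have hr : 0 < R - |v.im| := by
    have : 0 ≤ 4 * E / ε := by positivity
    linarith
  have := hrect t (R - |v.im|) ht0 hr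
  rw [add_sub_cancel] at this
  rw [dist_zero_right]
  refine this.trans_lt ?_
  have e1 : A / (2 * t) = ε / 4 := by
    rw [ht]; field_simp; norm_num
  have e2 : E / (R - |v.im|) ≤ ε / 4 := by
    rw [div_le_iff₀ hr]
    have : 4 * E / ε ≤ R - |v.im| := by linarith
    rw [div_le_iff₀ hε] at this
    linarith
  linarith

end HardySpace

/-! ### The Szegő kernel and its reproducing property. -/

lemma differentiableOn_kernel {u : ℂ} (hu : 0 < u.re) :
    DifferentiableOn ℂ (fun w : ℂ => (2 * Real.pi * (w + u))⁻¹) rightHalfPlane := fun w hw => by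
  have h : (2 * Real.pi * (w + u) : ℂ) ≠ 0 :=
    mul_ne_zero (by simp [Real.pi_ne_zero]) (add_ne_zero_of_re_pos hw hu)
  have hd : DifferentiableAt ℂ (fun w : ℂ => (2 * Real.pi * (w + u) : ℂ)) w := by fun_prop
  exact (hd.fun_inv h).differentiableWithinAt

/-- The reproducing kernel `w ↦ 1 / (2π (w + ū))` of the Hardy space. -/
noncomputable def szegoKernel (u : rightHalfPlane) : HardySpace where
  toFun := rightHalfPlane.indicator fun w => (2 * Real.pi * (w + conj (u : ℂ)))⁻¹
  memHardy := memHardy_indicator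
    (differentiableOn_kernel (by rw [conj_re]; exact u.2))
    (by rw [conj_re]; exact u.2) (d := conj (u : ℂ)) (M := (2 * Real.pi)⁻¹) fun w _ => le_of_eq (by
      rw [norm_inv, norm_mul, norm_mul, norm_real, Real.norm_of_nonneg Real.pi_pos.le,
        Complex.norm_ofNat, div_eq_mul_inv, mul_inv])

lemma szegoKernel_apply (u : rightHalfPlane) {w : ℂ} (hw : w ∈ rightHalfPlane) :
    szegoKernel u w = (2 * Real.pi * (w + conj (u : ℂ)))⁻¹ :=
  Set.indicator_of_mem hw fun w => (2 * Real.pi * (w + conj (u : ℂ)))⁻¹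

namespace HardySpace

/-- On the line Re z = x one has z̄ = 2x - z, so the conjugated kernel is the Cauchy kernel 1 /
(2π(v - z)) with pole v = 2x + u. The pole lies to the right of the line, whence the value at v. -/
lemma integral_szegoKernel_line (f : HardySpace) (u : rightHalfPlane) {x : ℝ} (hx : 0 < x) :
    ∫ y : ℝ, conj (szegoKernel u (x + y * I)) * f (x + y * I) = f (2 * x + u) := by
  have hu : 0 < (u : ℂ).re := u.2
  set v : ℂ := 2 * x + u with hv
  have hv0 : v ∈ rightHalfPlane := by
    simp only [rightHalfPlane, Set.mem_ofPred_eq, hv, add_re, mul_re, re_ofNat, ofReal_re,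
      im_ofNat, ofReal_im]
    linarith
  have hpi : (Real.pi : ℂ) ≠ 0 := by simp [Real.pi_ne_zero]
  set d : ℝ := (u : ℂ).re + x with hd
  have hd0 : 0 < d := by positivity
  have hdv : v + conj (u : ℂ) = 2 * d := by
    apply Complex.ext <;> simp [hv, hd]
    ring
  -- Since K_u(v) = 1 / (4πd), this multiple of K_u cancels f at v without leaving the Hardy space.
  -- Cauchy's theorem disposes of g, and the subtracted term leaves f(v) times a Poisson integral
  -- equal to 1.
  set g : HardySpace := f - (f v * (4 * Real.pi * d)) • szegoKernel u with hg
  have hgv : g v = 0 := by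
    rw [hg, sub_apply, smul_apply, szegoKernel_apply u hv0, hdv]
    have : (d : ℂ) ≠ 0 := by exact_mod_cast hd0.ne'
    field_simp
    ring
  have hq : DifferentiableOn ℂ (dslope g v) rightHalfPlane :=
    (Complex.differentiableOn_dslope (isOpen_rightHalfPlane.mem_nhds hv0)).2
      g.memHardy.differentiableOn
  have hmul : ∀ z ∈ rightHalfPlane, (z - v) * dslope g v z = g z := fun z _ => by
    have := sub_smul_dslope g.toFun v z
    rwa [hgv, sub_zero, smul_eq_mul] at this
  have hlim := tendsto_integral_line_of_sub_mul_eq g hq hmul hx (by simp [hv]; linarith)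
  have hI := integrable_inv_sq_add_sq hd0 (-(u : ℂ).im)
  have hIc : Integrable fun y : ℝ => (((d ^ 2 + (y + -(u : ℂ).im) ^ 2)⁻¹ : ℝ) : ℂ) := hI.ofReal
  have hlim₂ := intervalIntegral_tendsto_integral hIc
    tendsto_neg_atTop_atBot tendsto_id
  have hlim₃ := intervalIntegral_tendsto_integral (integrable_inner_line (szegoKernel u) f hx)
    tendsto_neg_atTop_atBot tendsto_id
  refine tendsto_nhds_unique hlim₃ ?_
  have hsum := (hlim.const_mul (-(2 * Real.pi : ℂ)⁻¹)).add
    (hlim₂.const_mul (f v * d * (Real.pi : ℂ)⁻¹))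
  have hval : -(2 * Real.pi : ℂ)⁻¹ * 0 + f v * d * (Real.pi : ℂ)⁻¹ *
      ∫ y : ℝ, (((d ^ 2 + (y + -(u : ℂ).im) ^ 2)⁻¹ : ℝ) : ℂ) = f v := by
    rw [integral_complex_ofReal, integral_inv_sq_add_sq hd0]
    have : (d : ℂ) ≠ 0 := by exact_mod_cast hd0.ne'
    push_cast
    field_simp
    ring
  have hval' := hval ▸ hsum
  refine hval'.congr fun R => ?_
  simp only [id]
  have hqc : Continuous fun y : ℝ => dslope g v (x + y * I) :=
    continuousOn_line hq (by simpa using hx)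
  rw [← intervalIntegral.integral_const_mul, ← intervalIntegral.integral_const_mul,
    ← intervalIntegral.integral_add ((hqc.const_mul _).intervalIntegrable _ _)
      (hIc.const_mul _).intervalIntegrable]
  refine intervalIntegral.integral_congr fun y _ => ?_
  have hz : (x + y * I : ℂ) ∈ rightHalfPlane := by simpa [rightHalfPlane] using hx
  have hm := hmul _ hz
  rw [hg, sub_apply, smul_apply, szegoKernel_apply u hz, ← hg] at hm
  rw [szegoKernel_apply u hz]
  set z : ℂ := x + y * I with hzdef
  have h1 : conj (z + conj (u : ℂ)) = v - z := by
    apply Complex.ext <;> simp [hv, hzdef] <;> ring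
  have h2 : (((d ^ 2 + (y + -(u : ℂ).im) ^ 2)⁻¹ : ℝ) : ℂ) = ((v - z) * (z + conj (u : ℂ)))⁻¹ := by
    rw [← h1, mul_comm, mul_conj, ofReal_inv]
    congr 2
    rw [normSq_apply]
    simp [hzdef, hd]
    ring
  have h3 : z + conj (u : ℂ) ≠ 0 := add_ne_zero_of_re_pos hz (by rwa [conj_re])
  have h4 : v - z ≠ 0 := by
    rw [← h1]
    exact (map_ne_zero _).2 h3
  have h5 : dslope g v z = (f z - f v * (4 * Real.pi * d) * (2 * Real.pi * (z + conj (u : ℂ)))⁻¹) /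
      (z - v) := by
    rw [eq_div_iff (by rwa [← neg_sub, neg_ne_zero]), ← hm, mul_comm]
  rw [h2]
  rw [h5, map_inv₀, map_mul, h1, ← neg_sub v z]
  simp only [map_mul, conj_ofReal, map_ofNat]
  field_simp
  ring

/-- The reproducing property of the Szegő kernel. -/
lemma inner_szegoKernel (f : HardySpace) (u : rightHalfPlane) :
    inner ℂ (szegoKernel u) f = f u := by
  have hu : 0 < (u : ℂ).re := u.2
  refine tendsto_nhds_unique (tendsto_integral_inner (szegoKernel u) f) ?_
  have hc : ContinuousAt f (u : ℂ) :=
    (f.memHardy.differentiableOn.differentiableAt (isOpen_rightHalfPlane.mem_nhds u.2)).continuousAt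
  have ht : Tendsto (fun x : ℝ => (2 * x + u : ℂ)) (𝓝[>] 0) (𝓝 (u : ℂ)) :=
    tendsto_nhdsWithin_of_tendsto_nhds (Continuous.tendsto' (by fun_prop) _ _ (by simp))
  refine (hc.tendsto.comp ht).congr' ?_
  filter_upwards [self_mem_nhdsWithin] with x hx
  exact (integral_szegoKernel_line f u hx).symm

/-- A function orthogonal to every kernel vanishes at every point. Hence identities between bounded
operators need checking on kernels only. -/
lemma dense_span_szegoKernel :
    Dense (Submodule.span ℂ (Set.range szegoKernel) : Set HardySpace) := by
  rw [Submodule.dense_iff_topologicalClosure_eq_top, Submodule.topologicalClosure_eq_top_iff,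
    Submodule.eq_bot_iff]
  intro f hf
  ext w hw
  rw [← inner_szegoKernel f ⟨w, hw⟩]
  exact hf _ (Submodule.subset_span ⟨_, rfl⟩)

end HardySpace

/-! ### Action of composition operators and their adjoints on kernels. -/

/-- The affine map `w ↦ a w + b` on `ℂ₊`. -/
def affineMap (a : ℝ) (b : ℂ) (ha : 0 < a) (hb : 0 ≤ b.re) (u : rightHalfPlane) :
    rightHalfPlane := ⟨a * u + b, affine_mem ha hb u.2⟩

/-- This is the factorization aw + b + ū = a(w + conj(a⁻¹u + a⁻¹b̄)). -/
lemma compositionOperator_szegoKernel (a : ℝ) (b : ℂ) (ha : 0 < a) (hb : 0 ≤ b.re)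
    (u : rightHalfPlane) : compositionOperator a b ha hb (szegoKernel u) =
      ((a⁻¹ : ℝ) : ℂ) • szegoKernel (affineMap a⁻¹ ((a⁻¹ : ℝ) * conj b) (inv_pos.2 ha)
        (re_dual_nonneg ha hb) u) := by
  ext w hw
  have ha' : (a : ℂ) ≠ 0 := by exact_mod_cast ha.ne'
  rw [compositionOperator_apply ha hb _ hw, HardySpace.smul_apply, szegoKernel_apply _ hw,
    szegoKernel_apply _ (affine_mem ha hb hw), affineMap]
  simp only [map_add, map_mul, conj_ofReal, conj_conj]
  rw [ofReal_inv, ← mul_inv]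
  congr 1
  field_simp
  ring

/-- `C_φ* K_u = K_{φ(u)}`. -/
lemma adjoint_compositionOperator_szegoKernel (a : ℝ) (b : ℂ) (ha : 0 < a) (hb : 0 ≤ b.re)
    (u : rightHalfPlane) :
    ContinuousLinearMap.adjoint (compositionOperator a b ha hb) (szegoKernel u) =
      szegoKernel (affineMap a b ha hb u) := by
  refine ext_inner_right ℂ fun f => ?_
  rw [ContinuousLinearMap.adjoint_inner_left, HardySpace.inner_szegoKernel,
    HardySpace.inner_szegoKernel, compositionOperator_apply ha hb f u.2]
  rfl

lemma compositionOperator_eq_smul_adjoint (a : ℝ) (b : ℂ) (ha : 0 < a) (hb : 0 ≤ b.re) :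
    compositionOperator a b ha hb = ((a⁻¹ : ℝ) : ℂ) • ContinuousLinearMap.adjoint
      (compositionOperator a⁻¹ ((a⁻¹ : ℝ) * conj b) (inv_pos.2 ha) (re_dual_nonneg ha hb)) := by
  refine ContinuousLinearMap.ext_on HardySpace.dense_span_szegoKernel ?_
  rintro _ ⟨u, rfl⟩
  rw [compositionOperator_szegoKernel, smul_apply,
    adjoint_compositionOperator_szegoKernel]

lemma adjoint_compositionOperator (a : ℝ) (b : ℂ) (ha : 0 < a) (hb : 0 ≤ b.re) :
    ContinuousLinearMap.adjoint (compositionOperator a b ha hb) = ((a⁻¹ : ℝ) : ℂ) •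
      compositionOperator a⁻¹ ((a⁻¹ : ℝ) * conj b) (inv_pos.2 ha) (re_dual_nonneg ha hb) := by
  conv_lhs => rw [compositionOperator_eq_smul_adjoint a b ha hb]
  rw [map_smulₛₗ, conj_ofReal, ContinuousLinearMap.adjoint_adjoint]

/-! ### Conjugations built from Gram matrices. -/

section Conjugation

variable {H ι : Type*} [NormedAddCommGroup H] [InnerProductSpace ℂ H] [CompleteSpace H]

/-- A family whose Gram matrix is the transpose of that of a total family `k` is the image of `k`
under a conjugate-linear isometry. -/
lemma exists_conjLinear_of_inner_eq {k l : ι → H}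
    (hk : Dense (Submodule.span ℂ (Set.range k) : Set H))
    (h : ∀ i j, inner ℂ (l i) (l j) = inner ℂ (k j) (k i)) :
    ∃ C : H →L⋆[ℂ] H, (∀ i, C (k i) = l i) ∧ ∀ f g, inner ℂ (C f) (C g) = inner ℂ g f := by
  set e : (ι →₀ ℂ) →ₗ[ℂ] H := Finsupp.linearCombination ℂ k with he
  set L : (ι →₀ ℂ) →ₗ⋆[ℂ] H := (Finsupp.linearCombination ℂ l).comp
    (Finsupp.mapRange.linearMap (starLinearEquiv ℂ : ℂ ≃ₗ⋆[ℂ] ℂ).toLinearMap) with hL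
  have hdense : DenseRange e := by
    rw [DenseRange, ← LinearMap.coe_range, he, Finsupp.range_linearCombination]
    exact hk
  have hinner : ∀ x y, inner ℂ (L x) (L y) = inner ℂ (e y) (e x) := fun x y => by
    induction x using Finsupp.induction_linear with
    | zero => simp
    | add x₁ x₂ h₁ h₂ => rw [map_add, map_add, inner_add_left, inner_add_right, h₁, h₂]
    | single i c =>
      induction y using Finsupp.induction_linear with
      | zero => simp
      | add y₁ y₂ h₁ h₂ => rw [map_add, map_add, inner_add_left, inner_add_right, h₁, h₂]
      | single j d =>
        simp [hL, he, h]
        ring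
  -- This bound makes `L` factor through `e`, so no linear independence of `k` is needed, and the
  -- factor extends to the closure.
  have hnorm : ∀ x, ‖L x‖ ≤ 1 * ‖e x‖ := fun x => by
    rw [one_mul, @norm_eq_sqrt_re_inner ℂ, hinner, ← @norm_eq_sqrt_re_inner ℂ]
  have hC : ∀ x, L.extendOfNorm e (e x) = L x := fun x =>
    LinearMap.extendOfNorm_eq hdense ⟨1, hnorm⟩ x
  refine ⟨L.extendOfNorm e, fun i => ?_, fun f g => ?_⟩
  · simpa [hL, he] using hC (Finsupp.single i 1)
  · refine hdense.induction_on₂ (p := fun f g => inner ℂ (L.extendOfNorm e f)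
      (L.extendOfNorm e g) = inner ℂ g f) (isClosed_eq (by fun_prop) (by fun_prop))
      (fun x y => ?_) f g
    rw [hC, hC, hinner]

/-- Complex symmetry is detected on a total family `k` that the conjugation permutes up to
scalars. -/
lemma isComplexSymmetric_of_total {k : ι → H}
    (hk : Dense (Submodule.span ℂ (Set.range k) : Set H)) {m : ι → ι} {α : ι → ℂ} {T : H →L[ℂ] H}
    (h : ∀ i j, inner ℂ (α i • k (m i)) (α j • k (m j)) = inner ℂ (k j) (k i))
    (hm : ∀ i, m (m i) = i) (hα : ∀ i, conj (α i) * α (m i) = 1)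
    {c : ℂ} {s t : ι → ι} (hT : ∀ i, T (k i) = c • k (s i))
    (hT' : ∀ i, ContinuousLinearMap.adjoint T (k i) = k (t i))
    (hst : ∀ i, m (s i) = t (m i)) (hc : ∀ i, conj c * α (s i) = α i) :
    IsComplexSymmetric T := by
  obtain ⟨C, hC, hinner⟩ := exists_conjLinear_of_inner_eq hk h
  refine ⟨C.toLinearMap, ⟨hinner, fun f => ?_⟩, fun f => ?_⟩
  · have : C.comp C = ContinuousLinearMap.id ℂ H := by
      refine ContinuousLinearMap.ext_on hk ?_
      rintro _ ⟨i, rfl⟩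
      simp [hC, hm, smul_smul, hα]
    exact congrArg (fun S : H →L[ℂ] H => S f) this
  -- On k i the two sides are conj c · α(s i) · k(m(s i)) and α i · k(t(m i)).
  · have : C.comp T = (ContinuousLinearMap.adjoint T).comp C := by
      refine ContinuousLinearMap.ext_on hk ?_
      rintro _ ⟨i, rfl⟩
      simp [hC, hT, hT', smul_smul, hc, hst]
    exact congrArg (fun S : H →L⋆[ℂ] H => S f) this

end Conjugation

/-! ### Normality. -/

lemma szegoKernel_injective : Function.Injective szegoKernel := fun u v h => by
  have h1 : (1 : ℂ) ∈ rightHalfPlane := by simp [rightHalfPlane]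
  have h2 : szegoKernel u 1 = szegoKernel v 1 := by rw [h]
  rw [szegoKernel_apply u h1, szegoKernel_apply v h1, inv_inj] at h2
  have h3 := mul_left_cancel₀ (by simp [Real.pi_ne_zero]) h2
  exact Subtype.ext ((starRingEnd ℂ).injective (add_left_cancel h3))

/-- T*T and TT* send K_u to a⁻¹ times the kernels at u + 2 Re b and u + 2a⁻¹ Re b. Distinct points
have distinct kernels, so normality means that these translations agree. -/
lemma isStarNormal_compositionOperator_iff (a : ℝ) (b : ℂ) (ha : 0 < a) (hb : 0 ≤ b.re) :
    IsStarNormal (compositionOperator a b ha hb) ↔ a = 1 ∨ b.re = 0 := by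
  have ha' : (a : ℂ) ≠ 0 := by exact_mod_cast ha.ne'
  have hpos := inv_pos.2 ha
  have hdual := re_dual_nonneg ha hb
  set T := compositionOperator a b ha hb with hT
  have h1 : ∀ u, (star T * T) (szegoKernel u) = ((a⁻¹ : ℝ) : ℂ) • szegoKernel
      (affineMap a b ha hb (affineMap a⁻¹ ((a⁻¹ : ℝ) * conj b) hpos hdual u)) := fun u => by
    rw [ContinuousLinearMap.star_eq_adjoint, mul_apply_eq_comp, hT,
      compositionOperator_szegoKernel, map_smul, adjoint_compositionOperator_szegoKernel]
  have h2 : ∀ u, (T * star T) (szegoKernel u) = ((a⁻¹ : ℝ) : ℂ) • szegoKernel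
      (affineMap a⁻¹ ((a⁻¹ : ℝ) * conj b) hpos hdual (affineMap a b ha hb u)) := fun u => by
    rw [ContinuousLinearMap.star_eq_adjoint, mul_apply_eq_comp, hT,
      adjoint_compositionOperator_szegoKernel, compositionOperator_szegoKernel]
  have h3 : ∀ u, affineMap a b ha hb (affineMap a⁻¹ ((a⁻¹ : ℝ) * conj b) hpos hdual u) =
      affineMap a⁻¹ ((a⁻¹ : ℝ) * conj b) hpos hdual (affineMap a b ha hb u) ↔
        a = 1 ∨ b.re = 0 := fun u => by
    have e1 : (a : ℂ) * ((a⁻¹ : ℝ) * u + (a⁻¹ : ℝ) * conj b) + b = u + 2 * b.re := by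
      have := re_eq_add_conj b
      push_cast
      field_simp
      rw [this]
      ring
    have e2 : ((a⁻¹ : ℝ) : ℂ) * (a * u + b) + (a⁻¹ : ℝ) * conj b = u + 2 * b.re * (a⁻¹ : ℝ) := by
      have := re_eq_add_conj b
      push_cast
      field_simp
      rw [this]
      ring
    rw [← Subtype.coe_inj]
    simp only [affineMap]
    rw [e1, e2, add_right_inj]
    norm_cast
    constructor
    · intro h
      rcases eq_or_ne b.re 0 with h0 | h0
      · exact Or.inr h0
      · left
        have : a⁻¹ = 1 := by
          have h5 : (2 * b.re) * a⁻¹ = (2 * b.re) * 1 := by linarith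
          exact mul_left_cancel₀ (mul_ne_zero two_ne_zero h0) h5
        exact inv_eq_one.1 this
    · rintro (h | h) <;> simp [h]
  constructor
  · intro h
    have h4 := h1 ⟨1, by simp [rightHalfPlane]⟩
    rw [h.star_comm_self.eq, h2] at h4
    have h5 := szegoKernel_injective (smul_right_injective _ (by simpa using ha.ne') h4)
    exact (h3 _).1 h5.symm
  · intro h
    refine ⟨ContinuousLinearMap.ext_on HardySpace.dense_span_szegoKernel ?_⟩
    rintro _ ⟨u, rfl⟩
    rw [h1, h2, (h3 u).2 h]

/-! ### Complex symmetry when a = 1 or Re b = 0. -/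

lemma inner_smul_szegoKernel (α β : ℂ) (u v : rightHalfPlane) :
    inner ℂ (α • szegoKernel u) (β • szegoKernel v) =
      conj α * β * (2 * Real.pi * ((u : ℂ) + conj (v : ℂ)))⁻¹ := by
  rw [inner_smul_left, inner_smul_right, HardySpace.inner_szegoKernel, szegoKernel_apply v u.2]
  ring

lemma inner_szegoKernel_szegoKernel (u v : rightHalfPlane) :
    inner ℂ (szegoKernel u) (szegoKernel v) = (2 * Real.pi * ((u : ℂ) + conj (v : ℂ)))⁻¹ := by
  simpa using inner_smul_szegoKernel 1 1 u v

/-- The conjugation sends K_u to K_ū; complex conjugation turns translation by b̄ into translation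
by b. -/
lemma isComplexSymmetric_of_eq_one {a : ℝ} {b : ℂ} (ha : 0 < a) (hb : 0 ≤ b.re) (h : a = 1) :
    IsComplexSymmetric (compositionOperator a b ha hb) := by
  subst h
  refine isComplexSymmetric_of_total HardySpace.dense_span_szegoKernel
    (m := fun u => ⟨conj (u : ℂ), show 0 < (conj (u : ℂ)).re by rw [conj_re]; exact u.2⟩)
    (α := fun _ => 1) (fun u v => ?_) (fun u => ?_) (fun u => by simp)
    (compositionOperator_szegoKernel 1 b ha hb)
    (adjoint_compositionOperator_szegoKernel 1 b ha hb) (fun u => ?_) (fun u => by simp)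
  · rw [inner_smul_szegoKernel, inner_szegoKernel_szegoKernel]
    simp [add_comm]
  · simp
  · simp [affineMap]

/-- The reflection `u ↦ p + 1 / conj (u - p)` of `ℂ₊`, for `p` on the imaginary axis. -/
noncomputable def circleReflection (p : ℂ) (hp : p.re = 0) (u : rightHalfPlane) :
    rightHalfPlane :=
  ⟨p + (conj ((u : ℂ) - p))⁻¹, by
    have hu : 0 < (u : ℂ).re := u.2
    have h : 0 < (conj ((u : ℂ) - p)).re := by simpa [hp] using hu
    have h0 : conj ((u : ℂ) - p) ≠ 0 := fun h0 => by simp [h0] at h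
    simp only [rightHalfPlane, Set.mem_ofPred_eq, add_re, hp, inv_re, zero_add]
    exact div_pos h (normSq_pos.2 h0)⟩

/-- Here φ is the dilation by a about its fixed point p = b / (1 - a) on the imaginary axis, and ψ
is its inverse. Inversion in the unit circle about p interchanges the two, and the factors (u - p)⁻¹
restore the Gram matrix. The fixed point exists because a ≠ 1. -/
lemma isComplexSymmetric_of_re_eq_zero {a : ℝ} {b : ℂ} (ha : 0 < a) (hb : 0 ≤ b.re)
    (ha1 : a ≠ 1) (h : b.re = 0) : IsComplexSymmetric (compositionOperator a b ha hb) := by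
  have ha' : (a : ℂ) ≠ 0 := by exact_mod_cast ha.ne'
  have ha1' : (1 - a : ℂ) ≠ 0 := by
    rw [sub_ne_zero]
    exact_mod_cast ha1.symm
  set p : ℂ := b / (1 - a : ℝ) with hp
  have hp0 : p.re = 0 := by rw [hp, div_ofReal_re, h, zero_div]
  have hbp : b = p * (1 - a) := by
    rw [hp]
    push_cast
    field_simp
  have hcp : conj p = -p := by
    apply Complex.ext <;> simp [hp0]
  have hcb : conj b = -b := by
    apply Complex.ext <;> simp [h]
  have hsub : ∀ u : rightHalfPlane, (u : ℂ) - p ≠ 0 := fun u h0 => by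
    have hu : 0 < (u : ℂ).re := u.2
    have := congrArg re h0
    simp [hp0] at this
    linarith
  have hadd : ∀ u : rightHalfPlane, conj (u : ℂ) + p ≠ 0 := fun u h0 => by
    apply hsub u
    rw [← conj_conj ((u : ℂ) - p), map_sub, hcp, sub_neg_eq_add, h0, map_zero]
  refine isComplexSymmetric_of_total HardySpace.dense_span_szegoKernel
    (m := circleReflection p hp0)
    (α := fun u => ((u : ℂ) - p)⁻¹) (fun u v => ?_) (fun u => ?_) (fun u => ?_)
    (compositionOperator_szegoKernel a b ha hb)
    (adjoint_compositionOperator_szegoKernel a b ha hb) (fun u => ?_) (fun u => ?_)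
  · rw [inner_smul_szegoKernel, inner_szegoKernel_szegoKernel]
    simp only [circleReflection, map_add, map_inv₀, map_sub, conj_conj, hcp, sub_neg_eq_add]
    have h1 := hadd u
    have h2 := hsub v
    rw [← mul_inv, ← mul_inv]
    congr 1
    rw [← sub_eq_add_neg (v : ℂ)]
    field_simp
    ring
  · apply Subtype.ext
    simp [circleReflection]
  · simp only [circleReflection, add_sub_cancel_left, inv_inv, map_inv₀]
    exact inv_mul_cancel₀ ((map_ne_zero _).2 (hsub u))
  · apply Subtype.ext
    have e : ((a⁻¹ : ℝ) : ℂ) * u + (a⁻¹ : ℝ) * conj b - p = (a⁻¹ : ℝ) * (u - p) := by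
      rw [hcb, hbp]
      push_cast
      field_simp
      ring
    simp only [circleReflection, affineMap, e]
    rw [map_mul, conj_ofReal, mul_inv, ofReal_inv, inv_inv, mul_add, hbp]
    ring
  · have e : ((a⁻¹ : ℝ) : ℂ) * u + (a⁻¹ : ℝ) * conj b - p = (a⁻¹ : ℝ) * (u - p) := by
      rw [hcb, hbp]
      push_cast
      field_simp
      ring
    simp only [affineMap, e, conj_ofReal]
    rw [mul_inv, ← mul_assoc, mul_inv_cancel₀ (by simpa using ha.ne'), one_mul]

/-! ### Cyclicity, adjoints and conjugations. -/

section Cyclic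

variable {H : Type*} [NormedAddCommGroup H] [InnerProductSpace ℂ H] [CompleteSpace H]

lemma isCyclicOperator_iff (T : H →L[ℂ] H) :
    IsCyclicOperator T ↔ ∃ f : H, ∀ g : H, (∀ n : ℕ, inner ℂ g ((T ^ n) f) = 0) → g = 0 := by
  refine exists_congr fun f => ?_
  rw [Submodule.dense_iff_topologicalClosure_eq_top, Submodule.topologicalClosure_eq_top_iff,
    Submodule.eq_bot_iff]
  refine forall_congr' fun g => imp_congr_left ⟨fun h n => ?_, fun h => ?_⟩
  · exact (Submodule.mem_orthogonal' _ _).1 h _ (Submodule.subset_span ⟨n, rfl⟩)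
  · have hle : Submodule.span ℂ (Set.range fun n : ℕ => (T ^ n) f) ≤ (ℂ ∙ g)ᗮ := by
      rw [Submodule.span_le]
      rintro _ ⟨n, rfl⟩
      exact Submodule.mem_orthogonal_singleton_iff_inner_right.2 (h n)
    exact (Submodule.mem_orthogonal' _ _).2 fun v hv =>
      Submodule.mem_orthogonal_singleton_iff_inner_right.1 (hle hv)

lemma IsCyclicOperator.smul {T : H →L[ℂ] H} (hT : IsCyclicOperator T) {c : ℂ} (hc : c ≠ 0) :
    IsCyclicOperator (c • T) := by
  rw [isCyclicOperator_iff] at hT ⊢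
  obtain ⟨f, hf⟩ := hT
  refine ⟨f, fun g hg => hf g fun n => ?_⟩
  have := hg n
  rw [smul_pow, smul_apply, inner_smul_right] at this
  exact (mul_eq_zero.1 this).resolve_left (pow_ne_zero n hc)

lemma IsComplexSymmetric.adjoint {T : H →L[ℂ] H} (hT : IsComplexSymmetric T) :
    IsComplexSymmetric (ContinuousLinearMap.adjoint T) := by
  obtain ⟨C, hC, h⟩ := hT
  refine ⟨C, hC, fun f => ?_⟩
  rw [ContinuousLinearMap.adjoint_adjoint]
  conv_lhs => rw [← hC.involutive f, ← h, hC.involutive]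

/-- C maps the T-orbit of f onto the T*-orbit of C f and preserves orthogonality, so C f is cyclic
for T*. -/
lemma IsCyclicOperator.adjoint {T : H →L[ℂ] H} (hcyc : IsCyclicOperator T)
    (hT : IsComplexSymmetric T) : IsCyclicOperator (ContinuousLinearMap.adjoint T) := by
  obtain ⟨C, hC, h⟩ := hT
  rw [isCyclicOperator_iff] at hcyc ⊢
  obtain ⟨f, hf⟩ := hcyc
  have hpow : ∀ n : ℕ, C ((T ^ n) f) = (ContinuousLinearMap.adjoint T ^ n) (C f) := fun n => by
    induction n with
    | zero => simp
    | succ n ih => rw [pow_succ', pow_succ', mul_apply_eq_comp,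
        mul_apply_eq_comp, h, ih]
  refine ⟨C f, fun g hg => ?_⟩
  have h0 : C g = 0 := hf _ fun n => by
    have := hC.isometric (C g) ((T ^ n) f)
    rw [hC.involutive, hpow, hg n] at this
    exact inner_eq_zero_symm.1 this.symm
  rw [← hC.involutive g, h0, map_zero]

/-- An operator whose adjoint has a multiple eigenvalue is not cyclic. -/
lemma not_isCyclicOperator_of_eigenvectors {T : H →L[ℂ] H} {μ : ℂ} {g₁ g₂ : H}
    (h₁ : ContinuousLinearMap.adjoint T g₁ = μ • g₁)
    (h₂ : ContinuousLinearMap.adjoint T g₂ = μ • g₂)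
    (hind : ∀ s t : ℂ, s • g₁ = t • g₂ → s = 0 ∧ t = 0) : ¬ IsCyclicOperator T := by
  rw [isCyclicOperator_iff]
  rintro ⟨f, hf⟩
  have key : ∀ g : H, ContinuousLinearMap.adjoint T g = μ • g → inner ℂ g f = 0 → g = 0 :=
    fun g hg h0 => hf g fun n => by
      induction n with
      | zero => simpa using h0
      | succ n ih => rw [pow_succ', mul_apply_eq_comp,
          ← ContinuousLinearMap.adjoint_inner_left, hg, inner_smul_left, ih, mul_zero]
  -- A two-dimensional eigenspace contains a nonzero vector orthogonal to f; by `key` it would be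
  -- orthogonal to the whole orbit.
  have h := key (conj (inner ℂ g₂ f) • g₁ - conj (inner ℂ g₁ f) • g₂)
    (by rw [map_sub, map_smul, map_smul, h₁, h₂, smul_sub, smul_comm μ, smul_comm μ])
    (by rw [inner_sub_left, inner_smul_left, inner_smul_left, conj_conj, conj_conj]; ring)
  have h' := (hind _ _ (sub_eq_zero.1 h)).2
  rw [map_eq_zero] at h'
  have h0 := key g₁ h₁ h'
  exact one_ne_zero (hind 1 0 (by simp [h0])).1

end Cyclic

/-! ### Type I: eigenvectors of the adjoint among shifted powers. -/

lemma norm_exp_mul_log_le (τ : ℝ) {z : ℂ} (hz : z ≠ 0) :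
    ‖exp (-(1 + τ * I) * log z)‖ ≤ Real.exp (|τ| * Real.pi) / ‖z‖ := by
  have hre : (-(1 + τ * I) * log z).re = τ * arg z - Real.log ‖z‖ := by
    simp [log_re, log_im]
    ring
  rw [norm_exp, hre, Real.exp_sub, Real.exp_log (norm_pos_iff.2 hz)]
  refine div_le_div_of_nonneg_right (Real.exp_le_exp.2 ?_) (norm_nonneg z)
  calc τ * arg z ≤ |τ * arg z| := le_abs_self _
    _ ≤ |τ| * Real.pi := by
      rw [abs_mul]
      gcongr
      exact abs_arg_le_pi z

/-- Homogeneity of z^(-1-iτ) under positive dilations, which do not affect the branch of the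
logarithm. -/
lemma exp_mul_log_ofReal_mul (τ : ℝ) {r : ℝ} (hr : 0 < r) {z : ℂ} (hz : z ≠ 0) :
    exp (-(1 + τ * I) * log (r * z)) =
      (r : ℂ)⁻¹ * exp (-((τ * Real.log r : ℝ) : ℂ) * I) * exp (-(1 + τ * I) * log z) := by
  have h : (r : ℂ)⁻¹ = exp (-(Real.log r : ℝ)) := by
    rw [exp_neg, ← ofReal_exp, Real.exp_log hr]
  rw [h, log_ofReal_mul hr hz, ← exp_add, ← exp_add]
  congr 1
  push_cast
  ring

/-- The function `w ↦ (w + c) ^ (-1 - iτ)` of the Hardy space. -/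
noncomputable def shiftedPower (c : ℂ) (hc : 0 < c.re) (τ : ℝ) : HardySpace where
  toFun := rightHalfPlane.indicator fun w => exp (-(1 + τ * I) * log (w + c))
  memHardy := memHardy_indicator (fun w hw => by
      have hs : w + c ∈ slitPlane := Or.inl (by
        have hw' : 0 < w.re := hw
        rw [add_re]
        linarith)
      have hd : DifferentiableAt ℂ (fun w : ℂ => exp (-(1 + τ * I) * log (w + c))) w :=
        (((differentiableAt_id.add_const c).clog hs).const_mul _).cexp
      exact hd.differentiableWithinAt) hc
    fun w hw => norm_exp_mul_log_le τ (add_ne_zero_of_re_pos hw hc)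

lemma shiftedPower_apply (c : ℂ) (hc : 0 < c.re) (τ : ℝ) {w : ℂ} (hw : w ∈ rightHalfPlane) :
    shiftedPower c hc τ w = exp (-(1 + τ * I) * log (w + c)) :=
  Set.indicator_of_mem hw fun w => exp (-(1 + τ * I) * log (w + c))

lemma not_isCyclicOperator_compositionOperator {a : ℝ} {b : ℂ} (ha : 0 < a) (hb : 0 ≤ b.re)
    (ha1 : a < 1) (hb0 : 0 < b.re) : ¬ IsCyclicOperator (compositionOperator a b ha hb) := by
  have ha' : (a : ℂ) ≠ 0 := by exact_mod_cast ha.ne'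
  have ha1' : (1 - a : ℂ) ≠ 0 := by
    rw [sub_ne_zero]
    exact_mod_cast ha1.ne'
  -- The fixed point of ψ is -c, in the left half-plane, so ψ(w) + c = a⁻¹(w + c) and powers of w +
  -- c are eigenvectors.
  set c : ℂ := conj b / (1 - a : ℝ) with hcdef
  have hc : 0 < c.re := by
    rw [hcdef, div_ofReal_re, conj_re]
    exact div_pos hb0 (by linarith)
  have hp1 : 1 < a⁻¹ := (one_lt_inv₀ ha).2 ha1
  have hp0 : 0 < a⁻¹ := inv_pos.2 ha
  have hlog : 0 < Real.log a⁻¹ := Real.log_pos hp1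
  -- The adjoint multiplies (w + c)^(-1-iσ) by exp(-iσ log a⁻¹), which is 1 for both σ = 0 and σ =
  -- τ.
  set τ : ℝ := 2 * Real.pi / Real.log a⁻¹ with hτ
  have heig : ∀ σ : ℝ, exp (-((σ * Real.log a⁻¹ : ℝ) : ℂ) * I) = 1 →
      ContinuousLinearMap.adjoint (compositionOperator a b ha hb) (shiftedPower c hc σ) =
        (1 : ℂ) • shiftedPower c hc σ := fun σ hσ => by
    rw [adjoint_compositionOperator, one_smul]
    ext w hw
    have e : ((a⁻¹ : ℝ) : ℂ) * w + (a⁻¹ : ℝ) * conj b + c = (a⁻¹ : ℝ) * (w + c) := by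
      rw [hcdef]
      push_cast
      field_simp
      ring
    rw [smul_apply, HardySpace.smul_apply, compositionOperator_apply _ _ _ hw,
      shiftedPower_apply c hc σ hw,
      shiftedPower_apply c hc σ (affine_mem hp0 (re_dual_nonneg ha hb) hw), e,
      exp_mul_log_ofReal_mul σ hp0 (add_ne_zero_of_re_pos hw hc), hσ]
    push_cast
    field_simp
  refine not_isCyclicOperator_of_eigenvectors (heig 0 (by simp)) (heig τ ?_) fun s t hst => ?_
  · rw [hτ, div_mul_cancel₀ _ hlog.ne', neg_mul, exp_neg]
    push_cast
    rw [exp_two_pi_mul_I, inv_one]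
  -- Dilating w + c by √a⁻¹ is half a period: apart from the common factor r⁻¹, it fixes the power
  -- with exponent parameter 0 and negates the one with τ. Comparing values at w = c and at the
  -- dilated point gives independence.
  · set r : ℝ := √a⁻¹ with hr
    have hr1 : 1 < r := by
      rw [hr]
      exact Real.lt_sqrt_of_sq_lt (by linarith)
    have hr0 : 0 < r := by linarith
    have hw : c ∈ rightHalfPlane := hc
    have hw' : r * (c + c) - c ∈ rightHalfPlane := by
      simp only [rightHalfPlane, Set.mem_ofPred_eq, sub_re, re_ofReal_mul, add_re]
      nlinarith
    have hcc : c + c ≠ 0 := add_ne_zero_of_re_pos hc hc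
    have E1 : s * shiftedPower c hc 0 c = t * shiftedPower c hc τ c :=
      congrArg (fun F : HardySpace => F c) hst
    have E2 : s * shiftedPower c hc 0 (r * (c + c) - c) =
        t * shiftedPower c hc τ (r * (c + c) - c) :=
      congrArg (fun F : HardySpace => F (r * (c + c) - c)) hst
    rw [shiftedPower_apply c hc _ hw, shiftedPower_apply c hc _ hw] at E1
    have hπ : exp (-((τ * Real.log r : ℝ) : ℂ) * I) = -1 := by
      have : τ * Real.log r = Real.pi := by
        rw [hτ, hr, Real.log_sqrt hp0.le]
        have hL := hlog.ne'
        generalize Real.log a⁻¹ = L at hL ⊢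
        field_simp
      rw [this, neg_mul, exp_neg, exp_pi_mul_I]
      norm_num
    have h0 : exp (-((0 * Real.log r : ℝ) : ℂ) * I) = 1 := by simp
    rw [shiftedPower_apply c hc _ hw', shiftedPower_apply c hc _ hw', sub_add_cancel,
      exp_mul_log_ofReal_mul τ hr0 hcc, exp_mul_log_ofReal_mul 0 hr0 hcc, hπ, h0] at E2
    have hX := exp_ne_zero (-(1 + (0 : ℝ) * I) * log (c + c))
    have hY := exp_ne_zero (-(1 + τ * I) * log (c + c))
    set X := exp (-(1 + (0 : ℝ) * I) * log (c + c))
    set Y := exp (-(1 + τ * I) * log (c + c))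
    have hrC : (r : ℂ) ≠ 0 := by exact_mod_cast hr0.ne'
    field_simp at E2
    have hs : s * X = 0 := by linear_combination (E1 + E2) / 2
    have ht : t * Y = 0 := by linear_combination (E2 - E1) / 2
    exact ⟨(mul_eq_zero.1 hs).resolve_right hX, (mul_eq_zero.1 ht).resolve_right hY⟩

/-! ### Type II: a cyclic kernel. -/

lemma isCyclicOperator_compositionOperator {a : ℝ} {b : ℂ} (ha : 0 < a) (hb : 0 ≤ b.re)
    (ha1 : 1 < a) (hb0 : 0 < b.re) : IsCyclicOperator (compositionOperator a b ha hb) := by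
  have ha' : (a : ℂ) ≠ 0 := by exact_mod_cast ha.ne'
  have ha1' : (a - 1 : ℂ) ≠ 0 := by
    rw [sub_ne_zero]
    exact_mod_cast ha1.ne'
  -- Now c is the attracting fixed point of ψ and lies in ℂ₊. The orbit of c + 1 under ψ is c + a⁻ⁿ,
  -- so a vector orthogonal to the orbit of the kernel at c + 1 has zeros accumulating at c.
  set c : ℂ := conj b / (a - 1 : ℝ) with hcdef
  have hc : c ∈ rightHalfPlane := by
    change 0 < c.re
    rw [hcdef, div_ofReal_re, conj_re]
    exact div_pos hb0 (by linarith)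
  have hp0 : 0 < a⁻¹ := inv_pos.2 ha
  have hv : ∀ n : ℕ, c + (a⁻¹ ^ n : ℝ) ∈ rightHalfPlane := fun n => by
    have hc' : 0 < c.re := hc
    have : 0 < a⁻¹ ^ n := pow_pos hp0 n
    simp only [rightHalfPlane, Set.mem_ofPred_eq, add_re, ofReal_re]
    linarith
  have hpow : ∀ n : ℕ, (compositionOperator a b ha hb ^ n) (szegoKernel ⟨_, hv 0⟩) =
      ((a⁻¹ ^ n : ℝ) : ℂ) • szegoKernel ⟨_, hv n⟩ := fun n => by
    induction n with
    | zero => simp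
    | succ n ih =>
      rw [pow_succ', mul_apply_eq_comp, ih, map_smul, compositionOperator_szegoKernel,
        smul_smul, ← ofReal_mul, ← pow_succ]
      congr 2
      apply Subtype.ext
      simp only [affineMap, hcdef, pow_succ]
      push_cast
      generalize (a : ℂ)⁻¹ ^ n = q
      field_simp
      ring
  rw [isCyclicOperator_iff]
  refine ⟨szegoKernel ⟨_, hv 0⟩, fun f hf => ?_⟩
  have hzero : ∀ n : ℕ, f (c + (a⁻¹ ^ n : ℝ)) = 0 := fun n => by
    have h := hf n
    rw [hpow, inner_smul_right, mul_eq_zero, inner_eq_zero_symm,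
      HardySpace.inner_szegoKernel] at h
    exact h.resolve_left (by exact_mod_cast (pow_pos hp0 n).ne')
  have hpre : IsPreconnected rightHalfPlane := (convex_halfSpace_re_gt 0).isPreconnected
  have hlim : Tendsto (fun n : ℕ => c + (a⁻¹ ^ n : ℝ)) atTop (𝓝[≠] c) := by
    refine tendsto_nhdsWithin_iff.2 ⟨?_, Eventually.of_forall fun n => ?_⟩
    · have h1 := tendsto_pow_atTop_nhds_zero_of_lt_one hp0.le (inv_lt_one_of_one_lt₀ ha1)
      have h2 := ((continuous_ofReal.tendsto 0).comp h1).const_add c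
      simpa [Function.comp_def] using h2
    · simp only [Set.mem_compl_iff, Set.mem_singleton_iff, add_eq_left]
      exact_mod_cast (pow_pos hp0 n).ne'
  have := (f.memHardy.differentiableOn.analyticOnNhd
    isOpen_rightHalfPlane).eqOn_zero_of_preconnected_of_frequently_eq_zero hpre hc
    (hlim.frequently (Frequently.of_forall hzero))
  ext w hw
  exact this hw

/-! ### Failure of complex symmetry for types I and II. -/

lemma not_isComplexSymmetric_of_lt_one {a : ℝ} {b : ℂ} (ha : 0 < a) (hb : 0 ≤ b.re)
    (ha1 : a < 1) (hb0 : 0 < b.re) : ¬ IsComplexSymmetric (compositionOperator a b ha hb) := by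
  intro h
  have hdual : 0 < ((a⁻¹ : ℝ) * conj b).re := by
    rw [re_ofReal_mul, conj_re]
    exact mul_pos (inv_pos.2 ha) hb0
  have hcyc := (isCyclicOperator_compositionOperator (inv_pos.2 ha) (re_dual_nonneg ha hb)
    ((one_lt_inv₀ ha).2 ha1) hdual).smul (c := ((a⁻¹ : ℝ) : ℂ)) (by simpa using ha.ne')
  rw [← adjoint_compositionOperator a b ha hb] at hcyc
  -- T* is cyclic, being a multiple of a type II operator; by symmetry T** = T would be cyclic as
  -- well.
  have := hcyc.adjoint h.adjoint
  rw [ContinuousLinearMap.adjoint_adjoint] at this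
  exact not_isCyclicOperator_compositionOperator ha hb ha1 hb0 this

lemma not_isComplexSymmetric_of_one_lt {a : ℝ} {b : ℂ} (ha : 0 < a) (hb : 0 ≤ b.re)
    (ha1 : 1 < a) (hb0 : 0 < b.re) : ¬ IsComplexSymmetric (compositionOperator a b ha hb) := by
  intro h
  have hdual : 0 < ((a⁻¹ : ℝ) * conj b).re := by
    rw [re_ofReal_mul, conj_re]
    exact mul_pos (inv_pos.2 ha) hb0
  -- By symmetry T* would be cyclic; the factor a turns it into the type I operator C_ψ.
  have hcyc := ((isCyclicOperator_compositionOperator ha hb ha1 hb0).adjoint h).smul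
    (c := (a : ℂ)) (by simpa using ha.ne')
  rw [adjoint_compositionOperator, smul_smul, ← ofReal_mul,
    mul_inv_cancel₀ ha.ne', ofReal_one, one_smul] at hcyc
  exact not_isCyclicOperator_compositionOperator (inv_pos.2 ha) (re_dual_nonneg ha hb)
    (inv_lt_one_of_one_lt₀ ha1) hdual hcyc

lemma isComplexSymmetric_compositionOperator_iff (a : ℝ) (b : ℂ) (ha : 0 < a) (hb : 0 ≤ b.re) :
    IsComplexSymmetric (compositionOperator a b ha hb) ↔ a = 1 ∨ b.re = 0 := by
  refine ⟨fun h => ?_, fun h => ?_⟩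
  · by_contra! hne
    have hb0 := lt_of_le_of_ne hb hne.2.symm
    rcases lt_or_gt_of_ne hne.1 with ha1 | ha1
    · exact not_isComplexSymmetric_of_lt_one ha hb ha1 hb0 h
    · exact not_isComplexSymmetric_of_one_lt ha hb ha1 hb0 h
  · by_cases ha1 : a = 1
    · exact isComplexSymmetric_of_eq_one ha hb ha1
    · exact isComplexSymmetric_of_re_eq_zero ha hb ha1 (h.resolve_left ha1)

end HalfPlaneHardy

theorem mainTheorem1 (a : ℝ) (b : ℂ) (ha : 0 < a) (hb : 0 ≤ b.re) :
    (HalfPlaneHardy.IsComplexSymmetric (HalfPlaneHardy.compositionOperator a b ha hb) ↔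
      a = 1 ∨ b.re = 0) ∧
    (HalfPlaneHardy.IsComplexSymmetric (HalfPlaneHardy.compositionOperator a b ha hb) ↔
      IsStarNormal (HalfPlaneHardy.compositionOperator a b ha hb)) ∧
    (a < 1 → 0 < b.re →
      ¬ HalfPlaneHardy.IsCyclicOperator (HalfPlaneHardy.compositionOperator a b ha hb)) ∧
    (1 < a → 0 < b.re →
      HalfPlaneHardy.IsCyclicOperator (HalfPlaneHardy.compositionOperator a b ha hb)) ∧
    HalfPlaneHardy.compositionOperator a b ha hb =
      ((a⁻¹ : ℝ) : ℂ) • ContinuousLinearMap.adjoint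
        (HalfPlaneHardy.compositionOperator a⁻¹ ((a⁻¹ : ℝ) * starRingEnd ℂ b) (inv_pos.2 ha)
          (HalfPlaneHardy.re_dual_nonneg ha hb)) := by
  exact ⟨HalfPlaneHardy.isComplexSymmetric_compositionOperator_iff a b ha hb,
    (HalfPlaneHardy.isComplexSymmetric_compositionOperator_iff a b ha hb).trans
      (HalfPlaneHardy.isStarNormal_compositionOperator_iff a b ha hb).symm,
    HalfPlaneHardy.not_isCyclicOperator_compositionOperator ha hb,
    HalfPlaneHardy.isCyclicOperator_compositionOperator ha hb,
    HalfPlaneHardy.compositionOperator_eq_smul_adjoint a b ha hb⟩
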